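/- Let $n\ge 1$ and $0\le k<n$. Let $F_n$ be the fan graph: its vertices are $0,1,\dots,n$, its edges are $\{0,i\}$ for $1\le i\le n$ and $\{i,i+1\}$ for $1\le i\le n-1$, and the vertex $0$ is the sink. A configuration is a vector $c=(c_1,\dots,c_n)$ of non-negative integers ($c_i$ is the number of grains at vertex $i$); a vertex $i\in\{1,\dots,n\}$ is unstable if $c_i\ge\deg(i)$, and $c$ is stable if no such vertex is unstable. In the Abelian sandpile model (ASM), toppling an unstable vertex $i$ sends one grain from $i$ to each of its neighbours. In the stochastic sandpile model (SSM) with parameter $p\in(0,1)$, toppling an unstable vertex $i$ sends, independently for each neighbour $j$ of $i$ and with probability $p$, one grain from $i$ to $j$. Grains sent to the sink disappear. Stabilising a configuration means toppling unstable vertices, one after another, until the configuration is stable (in the SSM, the next vertex to topple is chosen among the unstable ones by an arbitrary fixed function of the current configuration). Fix a probability distribution $\mu$ on $\{1,\dots,n\}$ with $\mu_i>0$ for all $i$. Each model defines a Markov chain on the set of stable configurations: at each step, add one grain at a random vertex of law $\mu$ and stabilise. A stable configuration is recurrent if the chain started from it almost surely visits it infinitely often. The level of $c$ is $$\mathrm{level}(c)=\sum_{i=1}^n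 c_i+\deg(0)-|E(F_n)|.$$ Let $\mathrm{Rec}(F_n)$ be the set of recurrent configurations on $F_n$, for either of the two models. Then $$\bigl|\{c\in\mathrm{Rec}(F_n):\ \mathrm{level}(c)=k\}\bigr|=\sum_{r=0}^{n-k-1}\binom{n-k-1}{r}\binom{r+k}{r}.$$ -/

import Mathlib

open MeasureTheory ProbabilityTheory Filter
open scoped ENNReal NNReal

namespace Sandpile

section MarkovChain

variable {S : Type*} [MeasurableSpace S] [Countable S] [MeasurableSingletonClass S]

/-- The transition kernel of a time-homogeneous Markov chain on a countable state space, given by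
the law `K s` of the next state when the current state is `s`. -/
noncomputable def stepKernel (K : S → PMF S) : Kernel S S :=
  Kernel.ofFunOfCountable fun s => (K s).toMeasure

instance (K : S → PMF S) : IsMarkovKernel (stepKernel K) :=
  ⟨fun s => inferInstanceAs (IsProbabilityMeasure (K s).toMeasure)⟩

/-- The law of the whole trajectory `(X 0, X 1, X 2, …)` of the Markov chain with transition
law `K`, started from `X 0 = s`. -/
noncomputable def chainLaw (K : S → PMF S) (s : S) : Measure (ℕ → S) :=
  Kernel.traj (X := fun _ : ℕ => S)
    (fun t => (stepKernel K).comap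
      (fun past : (i : Finset.Iic t) → S => past ⟨t, Finset.mem_Iic.2 le_rfl⟩)
      (measurable_pi_apply _)) 0 (fun _ => s)

/-- A state is recurrent if the chain started from it almost surely visits it at infinitely many
times. -/
def IsRecurrentState (K : S → PMF S) (s : S) : Prop :=
  ∀ᵐ X ∂(chainLaw K s), ∃ᶠ t in atTop, X t = s

end MarkovChain

/-! Graphs have vertex set `Fin (n + 1) = {0, …, n}`, and `0` is the sink. The non-sink vertices
`1, …, n` are indexed by `i : Fin n`, which stands for the vertex `i.succ`. -/

/-- The fan graph `F_n`: the sink `0` is joined to all other vertices, and the other vertices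
`1, …, n` form a path, in this order. -/
def fan (n : ℕ) : SimpleGraph (Fin (n + 1)) where
  Adj u v := u ≠ v ∧ (u = 0 ∨ v = 0 ∨ u.val + 1 = v.val ∨ v.val + 1 = u.val)
  symm := ⟨fun u v h => by grind⟩
  loopless := ⟨fun u h => h.1 rfl⟩

instance (n : ℕ) : DecidableRel (fan n).Adj := fun u v =>
  inferInstanceAs (Decidable (u ≠ v ∧ (u = 0 ∨ v = 0 ∨ u.val + 1 = v.val ∨ v.val + 1 = u.val)))

/-- Configurations: a number of grains at every non-sink vertex. -/
abbrev Config (n : ℕ) : Type := Fin n → ℕ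

section Model

variable {n : ℕ} (G : SimpleGraph (Fin (n + 1))) [DecidableRel G.Adj]

/-- The degree of the non-sink vertex `i`. Edges to the sink are counted. -/
def deg (i : Fin n) : ℕ := G.degree i.succ

/-- A vertex is unstable if it has at least as many grains as its degree. -/
def Unstable (c : Config n) (i : Fin n) : Prop := deg G i ≤ c i

/-- A configuration is stable if all its non-sink vertices are. -/
def Stable (c : Config n) : Prop := ∀ i, c i < deg G i

instance (c : Config n) : Decidable (Stable G c) :=
  inferInstanceAs (Decidable (∀ i, c i < deg G i))

/-- Move one grain from the vertex `i` to each vertex of `A`, a set of neighbours of `i`.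
Grains sent to the sink `0` disappear. This is used only when `i` has at least `A.card` grains, so
that the subtraction is not truncated. -/
def send (i : Fin n) (A : Finset (Fin (n + 1))) (c : Config n) : Config n := fun j =>
  (if j = i then c j - A.card else c j) + (if j.succ ∈ A then 1 else 0)

/-- The level `∑ c_i + deg(0) - |E|`. -/
def level (c : Config n) : ℤ :=
  (∑ i, (c i : ℤ)) + (G.degree 0 : ℤ) - (G.edgeFinset.card : ℤ)

/-- Adding one grain at the vertex `i`. -/
def addGrain (c : Config n) (i : Fin n) : Config n := c + Pi.single i 1

/-! ### The Abelian sandpile model -/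

/-- Toppling `i` in the Abelian model: one grain is sent to each neighbour. -/
def topple (i : Fin n) (c : Config n) : Config n := send i (G.neighborFinset i.succ) c

/-- `c'` is obtained from `c` by toppling one unstable vertex. -/
def LegalTopple (c c' : Config n) : Prop := ∃ i, Unstable G c i ∧ c' = topple G i c

/-- `c'` is stable and is obtained from `c` by successively toppling unstable vertices. -/
def IsStabilisation (c c' : Config n) : Prop :=
  Relation.ReflTransGen (LegalTopple G) c c' ∧ Stable G c'

open scoped Classical in
/-- The stabilisation of `c`. On a connected graph it exists and is unique, so that the second
branch does not occur there. -/
noncomputable def stabilise (c : Config n) : Config n :=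
  if h : ∃ c', IsStabilisation G c c' then h.choose else c

/-- One step of the Abelian sandpile Markov chain: add a grain at a vertex of law `μ`, then
stabilise. -/
noncomputable def asmStep (μ : PMF (Fin n)) (c : Config n) : PMF (Config n) :=
  μ.map fun i => stabilise G (addGrain c i)

/-- The recurrent configurations of the Abelian sandpile model: the stable configurations that are
recurrent for its Markov chain (which stays in the set of stable configurations). -/
def ASMRec (μ : PMF (Fin n)) : Set (Config n) :=
  {c | Stable G c ∧ IsRecurrentState (asmStep G μ) c}

/-! ### The stochastic sandpile model with parameter `p` -/

/-- The law of a random subset of a finite set `N`, each element of `N` being kept independently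
with probability `p`. -/
noncomputable def randomSubset {α : Type*} [DecidableEq α] (p : ℝ≥0) (hp : p ≤ 1)
    (N : Finset α) : PMF (Finset α) :=
  PMF.ofFinset
    (fun A => if A ⊆ N then (p : ℝ≥0∞) ^ A.card * ((1 - p : ℝ≥0) : ℝ≥0∞) ^ (N.card - A.card) else 0)
    N.powerset
    (by
      rw [Finset.sum_congr rfl fun A hA => if_pos (Finset.mem_powerset.1 hA),
        Finset.sum_pow_mul_eq_add_pow, ← ENNReal.coe_add, add_tsub_cancel_of_le hp]
      simp)
    (fun A hA => if_neg (by simpa using hA))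

/-- The law of the configuration after one random toppling of `i`: for each neighbour of `i`,
independently and with probability `p`, one grain is sent there. -/
noncomputable def randomTopple (p : ℝ≥0) (hp : p ≤ 1) (i : Fin n) (c : Config n) :
    PMF (Config n) :=
  (randomSubset p hp (G.neighborFinset i.succ)).map fun A => send i A c

/-- A rule that chooses which unstable vertex is toppled next. -/
def IsTopplingRule (σ : Config n → Fin n) : Prop := ∀ c, ¬ Stable G c → Unstable G c (σ c)

/-- The law of the configuration after at most `t` random topplings from `c`, in the order given by
the rule `σ`, where toppling stops as soon as the configuration is stable. -/
noncomputable def afterTopplings (σ : Config n → Fin n) (p : ℝ≥0) (hp : p ≤ 1) (c : Config n) :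
    ℕ → PMF (Config n)
  | 0 => PMF.pure c
  | t + 1 => (afterTopplings σ p hp c t).bind fun d =>
      if Stable G d then PMF.pure d else randomTopple G p hp (σ d) d

/-- The probability that random toppling from `c` ends in the stable configuration `c'`. The
probability of being in `c'` after at most `t` topplings increases with `t`. -/
noncomputable def stabilisationProb (σ : Config n → Fin n) (p : ℝ≥0) (hp : p ≤ 1)
    (c c' : Config n) : ℝ≥0∞ :=
  if Stable G c' then ⨆ t, afterTopplings G σ p hp c t c' else 0

/-- The probability law with given point masses. -/
noncomputable def lawOfMass {α : Type*} (m : α → ℝ≥0∞) (h : HasSum m 1) : PMF α := ⟨m, h⟩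

open scoped Classical in
/-- The law of the random stabilisation of `c`. On a connected graph with `0 < p`, and for a
toppling rule `σ`, random toppling almost surely ends, so that the second branch does not
occur there. -/
noncomputable def randomStabilise (σ : Config n → Fin n) (p : ℝ≥0) (hp : p ≤ 1)
    (c : Config n) : PMF (Config n) :=
  if h : HasSum (stabilisationProb G σ p hp c) 1 then lawOfMass _ h else PMF.pure c

/-- One step of the stochastic sandpile Markov chain: add a grain at a vertex of law `μ`, then
stabilise at random. -/
noncomputable def ssmStep (σ : Config n → Fin n) (p : ℝ≥0) (hp : p ≤ 1) (μ : PMF (Fin n))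
    (c : Config n) : PMF (Config n) :=
  μ.bind fun i => randomStabilise G σ p hp (addGrain c i)

/-- The recurrent configurations of the stochastic sandpile model: the stable configurations that
are recurrent for its Markov chain (which stays in the set of stable configurations). -/
def SSMRec (σ : Config n → Fin n) (p : ℝ≥0) (hp : p ≤ 1) (μ : PMF (Fin n)) : Set (Config n) :=
  {c | Stable G c ∧ IsRecurrentState (ssmStep G σ p hp μ) c}

end Model

end Sandpile

/-! For both models, a stable configuration is recurrent exactly when every interval of the path
carries at least as many grains as it has inner edges (`IntervalBound`). The counting formula is
then a statement about words over {0, 1, 2}.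

Necessity: `IntervalBound.send` shows that the bound survives every toppling, even a partial one.
Split the interval at the toppled vertex: what this vertex loses to its neighbours is gained by the
two pieces, and its degree pays for the rest. The maximal stable configuration satisfies the bound
and can be reached from every stable one, so a configuration violating the bound risks leaving
forever.

Sufficiency: `IntervalBound.burn` is Dhar's burning argument. If the bound holds for `c`, then `c +
1` topples back to `c`. Adding `1` three times to `c` passes above the maximal stable configuration,
so the Abelian chain can return from that configuration to `c`. A stochastic toppling can imitate an
Abelian one, so `isRecurrentState_iff_intervalBound` serves both models. Random stabilisation ends
almost surely because each random toppling loses at least `p ^ 3` grains on average.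

Counting: removing the first vertex couples two families, `tightConfigs` and `looseConfigs`, through
recurrences that are Pascal's rule for `tightSum` and `looseSum` (`ncard_configs`). -/

namespace Sandpile

/-! ### Recurrence criteria for Markov chains on countable spaces -/

section MarkovChain

variable {S : Type*} [MeasurableSpace S] [Countable S] [MeasurableSingletonClass S]

instance (K : S → PMF S) (s : S) : IsProbabilityMeasure (chainLaw K s) := by
  unfold chainLaw; infer_instance

/-- The states that can follow `s` in one step. -/
def CanStep (K : S → PMF S) (s t : S) : Prop := t ∈ (K s).support

lemma chainLaw_zero (K : S → PMF S) (s : S) : ∀ᵐ X ∂(chainLaw K s), X 0 = s := by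
  have h := Kernel.traj_map_frestrictLe_apply (X := fun _ : ℕ => S)
    (κ := fun t => (stepKernel K).comap
      (fun past : (i : Finset.Iic t) → S => past ⟨t, Finset.mem_Iic.2 le_rfl⟩)
      (measurable_pi_apply _)) 0 0 (fun _ => s)
  rw [Kernel.partialTraj_self, Kernel.id_apply] at h
  have h2 : ∀ᵐ x ∂((chainLaw K s).map (Preorder.frestrictLe (π := fun _ : ℕ => S) 0)),
      x ⟨0, Finset.mem_Iic.2 le_rfl⟩ = s := by
    unfold chainLaw
    rw [h, ae_dirac_iff]
    exact measurableSet_eq_fun (by fun_prop) (by fun_prop)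
  exact ae_of_ae_map (Preorder.measurable_frestrictLe 0).aemeasurable h2

lemma measurableSet_visit (t : ℕ) (d : S) :
    MeasurableSet[Filtration.piLE (X := fun _ : ℕ => S) t] {X : ℕ → S | X t = d} := by
  rw [Filtration.piLE_eq_comap_frestrictLe]
  exact ⟨{x | x ⟨t, Finset.mem_Iic.2 le_rfl⟩ = d},
    measurableSet_eq_fun (by fun_prop) (by fun_prop), rfl⟩

/-- This is the Markov property: given the past, the next coordinate has the law of one kernel step,
which sees only the last state. It is stated as a conditional expectation to fit the conditional
Borel–Cantelli lemma. -/
lemma condExp_visit (K : S → PMF S) (s e : S) (t : ℕ) :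
    (chainLaw K s)[({X : ℕ → S | X (t + 1) = e}).indicator (1 : (ℕ → S) → ℝ) |
      Filtration.piLE (X := fun _ : ℕ => S) t] =ᵐ[chainLaw K s] fun X => (K (X t) e).toReal := by
  have hm : MeasurableSet {X : ℕ → S | X (t + 1) = e} :=
    measurableSet_eq_fun (by fun_prop) (by fun_prop)
  refine (Kernel.condExp_traj (Nat.zero_le t) ?_).trans (ae_of_all _ fun X => ?_)
  · exact (integrable_const (1 : ℝ)).indicator hm
  · dsimp only
    rw [integral_indicator_one hm]
    have h := Kernel.map_traj_succ_self (X := fun _ : ℕ => S)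
      (κ := fun t => (stepKernel K).comap
      (fun past : (i : Finset.Iic t) → S => past ⟨t, Finset.mem_Iic.2 le_rfl⟩)
      (measurable_pi_apply _)) (a := t)
    have h2 := congrArg (fun κ => κ (Preorder.frestrictLe t X) {e}) h
    rw [Kernel.map_apply' _ (by fun_prop) _ (measurableSet_singleton e), Kernel.comap_apply] at h2
    rw [measureReal_def]
    congr 1
    refine h2.trans ?_
    exact PMF.toMeasure_apply_singleton _ _ (measurableSet_singleton e)

lemma chainLaw_step (K : S → PMF S) (s d e : S) (t : ℕ) :
    (chainLaw K s).real {X | X t = d ∧ X (t + 1) = e} =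
      (chainLaw K s).real {X | X t = d} * (K d e).toReal := by
  have hm : MeasurableSet {X : ℕ → S | X (t + 1) = e} :=
    measurableSet_eq_fun (by fun_prop) (by fun_prop)
  have hd : MeasurableSet {X : ℕ → S | X t = d} :=
    measurableSet_eq_fun (by fun_prop) (by fun_prop)
  have hint : Integrable (({X : ℕ → S | X (t + 1) = e}).indicator (1 : (ℕ → S) → ℝ))
      (chainLaw K s) := (integrable_const (1 : ℝ)).indicator hm
  have h := setIntegral_condExp (μ := chainLaw K s)
    ((Filtration.piLE (X := fun _ : ℕ => S)).le t) hint (measurableSet_visit t d)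
  rw [setIntegral_congr_ae (g := fun _ => (K d e).toReal) hd
    ((condExp_visit K s e t).mono fun X hX hXd => by
      rw [hX]; exact congrArg (fun x => (K x e).toReal) hXd),
    setIntegral_const, integral_indicator_one hm, smul_eq_mul, measureReal_restrict_apply hm] at h
  rw [h]
  congr 1
  ext X
  simp [and_comm]

lemma ae_canStep (K : S → PMF S) (s : S) :
    ∀ᵐ X ∂(chainLaw K s), ∀ t, CanStep K (X t) (X (t + 1)) := by
  rw [ae_all_iff]
  intro t
  have : ∀ d e, ¬ CanStep K d e → ∀ᵐ X ∂(chainLaw K s), ¬ (X t = d ∧ X (t + 1) = e) := by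
    intro d e h
    have h0 : K d e = 0 := by simpa [CanStep, PMF.mem_support_iff] using h
    have h1 := chainLaw_step K s d e t
    rw [h0, ENNReal.toReal_zero, mul_zero, measureReal_eq_zero_iff] at h1
    rw [ae_iff]
    simpa using h1
  have h2 : ∀ᵐ X ∂(chainLaw K s), ∀ d e, ¬ CanStep K d e → ¬ (X t = d ∧ X (t + 1) = e) := by
    simp only [ae_all_iff]
    exact this
  filter_upwards [h2] with X hX
  by_contra h
  exact hX _ _ h ⟨rfl, rfl⟩

lemma exists_visit_pos (K : S → PMF S) {s y : S} (h : Relation.ReflTransGen (CanStep K) s y) :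
    ∃ t, 0 < (chainLaw K s).real {X | X t = y} := by
  induction h with
  | refl =>
    refine ⟨0, ?_⟩
    have : (chainLaw K s) {X | X 0 = s} = 1 := by
      rw [prob_compl_eq_zero_iff (measurableSet_eq_fun (by fun_prop) (by fun_prop)) |>.symm]
      exact ae_iff.1 (chainLaw_zero K s)
    simp [measureReal_def, this]
  | @tail b c _ hbc ih =>
    obtain ⟨t, ht⟩ := ih
    refine ⟨t + 1, ?_⟩
    have h1 := chainLaw_step K s b c t
    have h2 : 0 < (K b c).toReal :=
      ENNReal.toReal_pos ((PMF.mem_support_iff _ _).1 hbc) (PMF.apply_ne_top _ _)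
    have h3 : 0 < (chainLaw K s).real {X | X t = b ∧ X (t + 1) = c} := by
      rw [h1]; positivity
    exact h3.trans_le (measureReal_mono fun X hX => hX.2)

/-- A state is not recurrent if the chain can move from it to a closed set that does not
contain it. -/
lemma not_isRecurrentState (K : S → PMF S) {s y : S} {C : Set S}
    (hC : ∀ x ∈ C, ∀ z, CanStep K x z → z ∈ C) (hs : s ∉ C) (hy : y ∈ C)
    (h : Relation.ReflTransGen (CanStep K) s y) : ¬ IsRecurrentState K s := by
  intro hrec
  obtain ⟨t, ht⟩ := exists_visit_pos K h
  -- A trajectory at `y` at time `t` is trapped in `C` and never sees `s` again; recurrence would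
  -- thus make this visit a null event.
  have h0 : ∀ᵐ X ∂(chainLaw K s), X t ≠ y := by
    filter_upwards [hrec, ae_canStep K s] with X hX hstep hXt
    have hin : ∀ u, X (t + u) ∈ C := by
      intro u
      induction u with
      | zero => simpa [hXt] using hy
      | succ u ih => exact hC _ ih _ (hstep _)
    obtain ⟨u, hu, hXu⟩ := (frequently_atTop.1 hX) t
    obtain ⟨v, rfl⟩ := Nat.exists_eq_add_of_le hu
    exact hs (hXu ▸ hin v)
  rw [ae_iff] at h0
  simp only [ne_eq, not_not] at h0
  simp [measureReal_def, h0] at ht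

/-- By Lévy's conditional Borel–Cantelli lemma, `e` is visited infinitely often as soon as the
conditional probabilities of visiting it have a divergent sum. Each visit to `d` contributes the
same positive term. -/
lemma ae_frequently_of_canStep (K : S → PMF S) (s : S) {d e : S} (h : CanStep K d e) :
    ∀ᵐ X ∂(chainLaw K s), (∃ᶠ t in atTop, X t = d) → ∃ᶠ t in atTop, X t = e := by
  have h1 := ae_mem_limsup_atTop_iff (ℱ := Filtration.piLE (X := fun _ : ℕ => S))
    (chainLaw K s) (s := fun t => {X : ℕ → S | X t = e}) (fun t => measurableSet_visit t e)
  have h2 := ae_all_iff.2 (condExp_visit K s e)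
  filter_upwards [h1, h2] with X hX hc hd
  rw [mem_limsup_iff_frequently_mem] at hX
  refine hX.2 ?_
  simp only [hc]
  rw [← not_summable_iff_tendsto_nat_atTop_of_nonneg (fun _ => ENNReal.toReal_nonneg)]
  intro hsum
  have hpos : 0 < (K d e).toReal :=
    ENNReal.toReal_pos ((PMF.mem_support_iff _ _).1 h) (PMF.apply_ne_top _ _)
  obtain ⟨t, ht, ht'⟩ := (hd.and_eventually
    (hsum.tendsto_atTop_zero.eventually (gt_mem_nhds hpos))).exists
  rw [ht] at ht'
  exact lt_irrefl _ ht'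

/-- A state of a finite closed set is recurrent if it can be reached from everywhere in
that set. -/
lemma isRecurrentState_of_finite (K : S → PMF S) {s : S} {C : Set S} (hfin : C.Finite)
    (hC : ∀ x ∈ C, ∀ z, CanStep K x z → z ∈ C) (hs : s ∈ C)
    (h : ∀ x ∈ C, Relation.ReflTransGen (CanStep K) x s) : IsRecurrentState K s := by
  have hreach : ∀ x ∈ C, ∀ᵐ X ∂(chainLaw K s),
      (∃ᶠ t in atTop, X t = x) → ∃ᶠ t in atTop, X t = s := by
    intro x hx
    have h' := h x hx
    clear hx
    induction h' using Relation.ReflTransGen.head_induction_on with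
    | refl => exact ae_of_all _ fun _ h => h
    | head hab _ ih =>
      filter_upwards [ae_frequently_of_canStep K s hab, ih] with X h1 h2 h3 using h2 (h1 h3)
  have hall : ∀ᵐ X ∂(chainLaw K s), ∀ x ∈ C,
      (∃ᶠ t in atTop, X t = x) → ∃ᶠ t in atTop, X t = s :=
    (ae_ball_iff hfin.countable).2 hreach
  unfold IsRecurrentState
  filter_upwards [hall, chainLaw_zero K s, ae_canStep K s] with X hX h0 hstep
  have hin : ∀ t, X t ∈ C := by
    intro t
    induction t with
    | zero => simpa [h0] using hs
    | succ t ih => exact hC _ ih _ (hstep t)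
  -- Pigeonhole: the trajectory stays in a finite set, so some state of it is visited infinitely
  -- often.
  have hfr : ∃ᶠ t in atTop, ∃ x ∈ C, X t = x :=
    Frequently.of_forall fun t => ⟨X t, hin t, rfl⟩
  by_contra hcon
  have : ∀ x ∈ C, ∀ᶠ t in atTop, X t ≠ x := fun x hx =>
    not_frequently.1 fun hf => hcon (hX x hx hf)
  have h3 := (eventually_all_finite hfin).2 this
  obtain ⟨t, ⟨x, hx, hxt⟩, ht⟩ := (hfr.and_eventually h3).exists
  exact ht x hx hxt

end MarkovChain

variable {n : ℕ}

/-! ### Degrees and grain counts on the fan -/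

section Fan

lemma fan_adj_zero (i : Fin n) : (fan n).Adj i.succ 0 :=
  ⟨Fin.succ_ne_zero i, Or.inr (Or.inl rfl)⟩

lemma fan_adj_succ (i j : Fin n) :
    (fan n).Adj i.succ j.succ ↔ i.val + 1 = j.val ∨ j.val + 1 = i.val := by
  simp only [fan, Fin.val_succ, Fin.ext_iff, ne_eq, Fin.val_zero]
  omega

/-- The vertex `i.succ` has number `i.val + 1`, so its neighbours on the path have numbers `i.val`
and `i.val + 2`. For `i.val = 0` the former is the sink, already listed. -/
lemma map_val_neighborFinset (i : Fin n) :
    ((fan n).neighborFinset i.succ).map Fin.valEmbedding =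
      {0} ∪ (if 0 < i.val then {i.val} else ∅) ∪ (if i.val + 1 < n then {i.val + 2} else ∅) := by
  ext v
  simp only [Finset.mem_map, SimpleGraph.mem_neighborFinset, Fin.valEmbedding_apply,
    Finset.mem_union, Finset.mem_singleton]
  constructor
  · rintro ⟨u, hu, rfl⟩
    induction u using Fin.cases with
    | zero => simp
    | succ j =>
      rw [fan_adj_succ] at hu
      have := j.isLt
      rcases hu with h | h
      · right
        rw [if_pos (by omega)]
        simp [← h]
      · left; right
        rw [if_pos (by omega)]
        simp [← h]
  · rintro ((h | h) | h)
    · exact ⟨0, fan_adj_zero i, by simp [h]⟩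
    · split_ifs at h with h0
      · rw [Finset.mem_singleton] at h
        refine ⟨(⟨i.val - 1, by omega⟩ : Fin n).succ, (fan_adj_succ _ _).2 (Or.inr ?_), ?_⟩
        · simp only; omega
        · simp only [Fin.val_succ]; omega
      · simp at h
    · split_ifs at h with h0
      · rw [Finset.mem_singleton] at h
        exact ⟨(⟨i.val + 1, h0⟩ : Fin n).succ, (fan_adj_succ _ _).2 (Or.inl rfl), by simp [h]⟩
      · simp at h

lemma deg_fan (i : Fin n) :
    deg (fan n) i = 1 + (if 0 < i.val then 1 else 0) + (if i.val + 1 < n then 1 else 0) := by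
  rw [deg, ← SimpleGraph.card_neighborFinset_eq_degree, ← Finset.card_map Fin.valEmbedding,
    map_val_neighborFinset]
  have := i.isLt
  split_ifs with h1 h2 h2
  · rw [Finset.card_union_of_disjoint, Finset.card_union_of_disjoint]
    · simp
    · simp; omega
    · simp
  · rw [Finset.union_empty, Finset.card_union_of_disjoint]
    · simp
    · simp; omega
  · simp
  · simp

/-- The indicator of the presence in `A` of the vertex with number `v`. -/
def hasVertex {m : ℕ} (A : Finset (Fin m)) (v : ℕ) : ℕ :=
  if v ∈ A.map Fin.valEmbedding then 1 else 0

lemma hasVertex_le_one {m : ℕ} (A : Finset (Fin m)) (v : ℕ) : hasVertex A v ≤ 1 := by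
  unfold hasVertex; split_ifs <;> simp

lemma hasVertex_val {m : ℕ} (A : Finset (Fin m)) (v : Fin m) :
    hasVertex A v.val = if v ∈ A then 1 else 0 := by
  simp [hasVertex, Finset.mem_map, ← Fin.ext_iff]

lemma card_le_of_forall_val {m : ℕ} (A : Finset (Fin m)) (u v w : ℕ)
    (h : ∀ x ∈ A, x.val = u ∨ x.val = v ∨ x.val = w) :
    A.card ≤ hasVertex A u + hasVertex A v + hasVertex A w := by
  classical
  rw [← Finset.card_map Fin.valEmbedding]
  have key : ∀ B : Finset ℕ, (∀ x ∈ B, x = u ∨ x = v ∨ x = w) →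
      B.card ≤ (if u ∈ B then 1 else 0) + (if v ∈ B then 1 else 0) + (if w ∈ B then 1 else 0) := by
    intro B hB
    have hsub : B ⊆ ((if u ∈ B then {u} else ∅) ∪ (if v ∈ B then {v} else ∅)) ∪
        (if w ∈ B then {w} else ∅) := by
      intro x hx
      simp only [Finset.mem_union]
      rcases hB x hx with rfl | rfl | rfl <;> simp [hx]
    refine (Finset.card_le_card hsub).trans ?_
    refine (Finset.card_union_le _ _).trans (Nat.add_le_add ?_ ?_)
    · refine (Finset.card_union_le _ _).trans (Nat.add_le_add ?_ ?_) <;> split_ifs <;> simp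
    · split_ifs <;> simp
  refine key _ ?_
  intro x hx
  obtain ⟨y, hy, rfl⟩ := Finset.mem_map.1 hx
  exact h y hy

lemma card_le_of_subset_neighborFinset {i : Fin n} {A : Finset (Fin (n + 1))}
    (hA : A ⊆ (fan n).neighborFinset i.succ) :
    A.card ≤ 1 + (if 0 < i.val then hasVertex A i.val else 0) + hasVertex A (i.val + 2) := by
  have h1 : ∀ x ∈ A, x.val = 0 ∨ x.val = i.val ∨ x.val = i.val + 2 := by
    intro x hx
    have := Finset.mem_map_of_mem Fin.valEmbedding (hA hx)
    rw [map_val_neighborFinset] at this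
    simp only [Finset.mem_union, Finset.mem_singleton, Fin.valEmbedding_apply] at this
    rcases this with (h | h) | h
    · exact Or.inl h
    · split_ifs at h <;> simp at h; exact Or.inr (Or.inl h)
    · split_ifs at h <;> simp at h; exact Or.inr (Or.inr h)
  have h0 := hasVertex_le_one A 0
  split_ifs with hi
  · have := card_le_of_forall_val A _ _ _ h1
    omega
  -- Without a left neighbour one slot is idle; it is filled with `n + 1`, which is the number of no
  -- vertex.
  · have := card_le_of_forall_val A 0 (i.val + 2) (n + 1) (fun x hx => by
      rcases h1 x hx with h | h | h <;> omega)
    have h2 : hasVertex A (n + 1) = 0 := by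
      refine if_neg fun h => ?_
      obtain ⟨y, _, hy⟩ := Finset.mem_map.1 h
      have := y.isLt
      simp only [Fin.valEmbedding_apply] at hy
      omega
    omega

/-- The total number of grains. -/
def total (c : Config n) : ℕ := ∑ i, c i

lemma total_send (i : Fin n) (A : Finset (Fin (n + 1))) (c : Config n) (h : A.card ≤ c i) :
    total (send i A c) + (if 0 ∈ A then 1 else 0) = total c := by
  have h1 : (∑ j, if j = i then c j - A.card else c j) + A.card = total c := by
    have : A.card = ∑ j, if j = i then A.card else 0 := by simp
    conv_lhs => rw [this]
    rw [← Finset.sum_add_distrib]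
    refine Finset.sum_congr rfl fun j _ => ?_
    simp only [← this]
    split_ifs with hj
    · subst hj; omega
    · rfl
  have h2 : A.card = (if 0 ∈ A then 1 else 0) + ∑ j : Fin n, if j.succ ∈ A then 1 else 0 := by
    rw [← Fin.sum_univ_succ (fun v => if v ∈ A then 1 else 0)]
    simp
  unfold total send at *
  rw [Finset.sum_add_distrib]
  omega

lemma deg_eq_add_sum (i : Fin n) :
    deg (fan n) i = 1 + ∑ j : Fin n, if (fan n).Adj i.succ j.succ then 1 else 0 := by
  have : deg (fan n) i = ∑ v, if (fan n).Adj i.succ v then 1 else 0 := by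
    rw [deg, ← SimpleGraph.card_neighborFinset_eq_degree, SimpleGraph.neighborFinset_eq_filter]
    simp
  rw [this, Fin.sum_univ_succ, if_pos (fan_adj_zero i)]

lemma card_neighborFinset_fan (i : Fin n) :
    ((fan n).neighborFinset i.succ).card = deg (fan n) i :=
  SimpleGraph.card_neighborFinset_eq_degree _ _

lemma deg_pos_fan (i : Fin n) : 0 < deg (fan n) i := by rw [deg_fan]; omega

lemma deg_le_three (i : Fin n) : deg (fan n) i ≤ 3 := by
  rw [deg_fan]; split_ifs <;> omega

/-- The sink has degree `n` and the other degrees sum to `3 * n - 2`, so by the handshake lemma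
there are `2 * n - 1` edges. -/
lemma level_fan (hn : 1 ≤ n) (c : Config n) :
    level (fan n) c = (total c : ℤ) + 1 - n := by
  have h0 : (fan n).degree 0 = n := by
    rw [← SimpleGraph.card_neighborFinset_eq_degree, SimpleGraph.neighborFinset_eq_filter]
    have : ∀ v : Fin (n + 1), (fan n).Adj 0 v ↔ v ≠ 0 := by
      intro v
      simp [fan, eq_comm]
    simp only [this]
    rw [Finset.filter_ne', Finset.card_erase_of_mem (Finset.mem_univ _)]
    simp
  have h1 := (fan n).sum_degrees_eq_twice_card_edges
  rw [Fin.sum_univ_succ, h0] at h1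
  have h2 : ∑ i : Fin n, (fan n).degree i.succ + 2 = 3 * n := by
    have : ∀ i : Fin n, (fan n).degree i.succ =
      1 + (if 0 < i.val then 1 else 0) + (if i.val + 1 < n then 1 else 0) := deg_fan
    simp only [this]
    rw [Finset.sum_add_distrib, Finset.sum_add_distrib]
    have e1 : (∑ i : Fin n, if 0 < i.val then 1 else 0) + 1 = n := by
      obtain ⟨m, rfl⟩ := Nat.exists_eq_add_of_le' hn
      rw [Fin.sum_univ_succ]; simp
    have e2 : (∑ i : Fin n, if i.val + 1 < n then 1 else 0) + 1 = n := by
      obtain ⟨m, rfl⟩ := Nat.exists_eq_add_of_le' hn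
      rw [Fin.sum_univ_castSucc]; simp
    simp only [Finset.sum_const, Finset.card_univ, Fintype.card_fin, smul_eq_mul, mul_one]
    omega
  unfold level total
  rw [h0]
  push_cast
  omega

end Fan

/-! ### Termination and confluence of Abelian toppling -/

section Toppling

lemma send_add (i : Fin n) (A : Finset (Fin (n + 1))) (c x : Config n) (h : A.card ≤ c i) :
    send i A (c + x) = send i A c + x := by
  funext j
  simp only [send, Pi.add_apply]
  by_cases hj : j = i
  · subst hj; simp only [if_true]; omega
  · simp only [hj, if_false]; omega

lemma send_comm {i j : Fin n} (hij : i ≠ j) (A B : Finset (Fin (n + 1))) (c : Config n)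
    (hA : A.card ≤ c i) (hB : B.card ≤ c j) : send i A (send j B c) = send j B (send i A c) := by
  funext x
  simp only [send]
  by_cases h1 : x = i
  · subst h1; simp only [if_true, hij, if_false]; omega
  · by_cases h2 : x = j
    · subst h2; simp only [if_true, h1, if_false]; omega
    · simp only [h1, h2, if_false]; omega

lemma le_send {i j : Fin n} (hij : j ≠ i) (A : Finset (Fin (n + 1))) (c : Config n) :
    c j ≤ send i A c j := by
  simp [send, hij]

lemma LegalTopple.add {c d : Config n} (h : LegalTopple (fan n) c d) (x : Config n) :
    LegalTopple (fan n) (c + x) (d + x) := by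
  obtain ⟨i, hi, rfl⟩ := h
  exact ⟨i, le_add_right hi, (send_add _ _ _ _ (by rwa [card_neighborFinset_fan])).symm⟩

lemma reflTransGen_add {c d : Config n} (h : Relation.ReflTransGen (LegalTopple (fan n)) c d)
    (x : Config n) : Relation.ReflTransGen (LegalTopple (fan n)) (c + x) (d + x) :=
  h.lift (· + x) fun _ _ h => h.add x

/-- Every vertex is adjacent to the sink, so every toppling loses a grain. This makes the total a
termination measure. -/
lemma LegalTopple.total_lt {c d : Config n} (h : LegalTopple (fan n) c d) :
    total d < total c := by
  obtain ⟨i, hi, rfl⟩ := h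
  have := total_send i ((fan n).neighborFinset i.succ) c (by rwa [card_neighborFinset_fan])
  rw [if_pos (by simpa using fan_adj_zero i)] at this
  unfold topple
  omega

lemma not_stable_iff {c : Config n} : ¬ Stable (fan n) c ↔ ∃ i, Unstable (fan n) c i := by
  simp [Stable, Unstable]

/-- Toppling one vertex only adds grains elsewhere, so another unstable vertex stays unstable and
the two topplings commute. -/
lemma LegalTopple.diamond {a b c : Config n} (hb : LegalTopple (fan n) a b)
    (hc : LegalTopple (fan n) a c) : ∃ d, Relation.ReflGen (LegalTopple (fan n)) b d ∧
      Relation.ReflTransGen (LegalTopple (fan n)) c d := by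
  obtain ⟨i, hi, rfl⟩ := hb
  obtain ⟨j, hj, rfl⟩ := hc
  by_cases hij : i = j
  · subst hij
    exact ⟨_, .refl, .refl⟩
  · refine ⟨topple (fan n) j (topple (fan n) i a), .single ⟨j, ?_, rfl⟩,
      .single ⟨i, ?_, ?_⟩⟩
    · exact le_trans hj (le_send (Ne.symm hij) _ _)
    · exact le_trans hi (le_send hij _ _)
    · exact send_comm (Ne.symm hij) _ _ _ (by rwa [card_neighborFinset_fan])
        (by rwa [card_neighborFinset_fan])

lemma Stable.eq_of_reflTransGen {c d : Config n} (hc : Stable (fan n) c)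
    (h : Relation.ReflTransGen (LegalTopple (fan n)) c d) : d = c := by
  rcases h.cases_head with h | ⟨e, ⟨i, hi, _⟩, _⟩
  · exact h.symm
  · exact absurd hi (not_le.2 (hc i))

/-- A stabilisation of `a` is also a stabilisation of everything obtained from `a` by legal
topplings. -/
lemma IsStabilisation.of_reflTransGen {a b s : Config n} (hs : IsStabilisation (fan n) a s)
    (hb : Relation.ReflTransGen (LegalTopple (fan n)) a b) : IsStabilisation (fan n) b s := by
  obtain ⟨d, hbd, hsd⟩ := Relation.church_rosser
    (fun _ _ _ h h' => LegalTopple.diamond h h') hb hs.1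
  rw [hs.2.eq_of_reflTransGen hsd] at hbd
  exact ⟨hbd, hs.2⟩

lemma IsStabilisation.unique {a s t : Config n} (hs : IsStabilisation (fan n) a s)
    (ht : IsStabilisation (fan n) a t) : s = t :=
  ht.2.eq_of_reflTransGen (hs.of_reflTransGen ht.1).1

lemma exists_isStabilisation (c : Config n) : ∃ d, IsStabilisation (fan n) c d := by
  induction h : total c using Nat.strong_induction_on generalizing c with
  | _ m ih =>
    subst h
    by_cases hc : Stable (fan n) c
    · exact ⟨c, .refl, hc⟩
    · obtain ⟨i, hi⟩ := not_stable_iff.1 hc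
      have hl : LegalTopple (fan n) c (topple (fan n) i c) := ⟨i, hi, rfl⟩
      obtain ⟨d, hd⟩ := ih _ hl.total_lt _ rfl
      exact ⟨d, .head hl hd.1, hd.2⟩

lemma stabilise_spec (c : Config n) : IsStabilisation (fan n) c (stabilise (fan n) c) := by
  unfold stabilise
  rw [dif_pos (exists_isStabilisation c)]
  exact (exists_isStabilisation c).choose_spec

lemma IsStabilisation.stabilise_eq {c d : Config n} (h : IsStabilisation (fan n) c d) :
    stabilise (fan n) c = d := (stabilise_spec c).unique h

lemma Stable.stabilise_eq {c : Config n} (h : Stable (fan n) c) : stabilise (fan n) c = c :=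
  IsStabilisation.stabilise_eq ⟨.refl, h⟩

end Toppling

/-! ### The interval bound and its invariance under partial topplings -/

/-- The number of grains at the `j`-th vertex of the path, and `0` outside of the path. -/
def grains (c : Config n) (j : ℕ) : ℕ := if h : j < n then c ⟨j, h⟩ else 0

lemma grains_val (c : Config n) (i : Fin n) : grains c i.val = c i := by
  simp [grains, i.isLt]

/-- Every interval of the path carries at least as many grains as it has inner edges. -/
def IntervalBound (c : Config n) : Prop :=
  ∀ a b, a ≤ b → b ≤ n → b ≤ a + 1 + ∑ j ∈ Finset.Ico a b, grains c j

lemma IntervalBound.mono {c d : Config n} (h : IntervalBound c) (hcd : c ≤ d) :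
    IntervalBound d := by
  intro a b hab hb
  refine (h a b hab hb).trans (Nat.add_le_add_left (Finset.sum_le_sum fun j _ => ?_) _)
  unfold grains
  split_ifs
  · exact hcd _
  · exact le_rfl

lemma hasVertex_succ_le_grains_send (i : Fin n) (A : Finset (Fin (n + 1))) (c : Config n)
    {j : ℕ} (hj : j ≠ i.val) (hjn : j < n) :
    grains c j + hasVertex A (j + 1) ≤ grains (send i A c) j := by
  have h1 : (⟨j, hjn⟩ : Fin n) ≠ i := fun h => hj (by rw [← h])
  have h2 := hasVertex_val A (⟨j, hjn⟩ : Fin n).succ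
  simp only [Fin.val_succ] at h2
  simp [grains, send, hjn, h1, h2]

/-- Sending grains from an unstable vertex to some of its neighbours preserves the bound on
intervals. -/
lemma IntervalBound.send {c : Config n} (h : IntervalBound c) {i : Fin n}
    (hi : Unstable (fan n) c i) {A : Finset (Fin (n + 1))}
    (hA : A ⊆ (fan n).neighborFinset i.succ) : IntervalBound (send i A c) := by
  intro a b hab hb
  have hge : ∀ j, j ≠ i.val → grains c j ≤ grains (Sandpile.send i A c) j := by
    intro j hj
    by_cases hjn : j < n
    · exact le_trans (Nat.le_add_right _ _) (hasVertex_succ_le_grains_send i A c hj hjn)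
    · simp [grains, hjn]
  have hsum : ∀ u v, (i.val < u ∨ v ≤ i.val) →
      ∑ j ∈ Finset.Ico u v, grains c j ≤ ∑ j ∈ Finset.Ico u v, grains (Sandpile.send i A c) j := by
    intro u v huv
    refine Finset.sum_le_sum fun j hj => hge j ?_
    rw [Finset.mem_Ico] at hj
    omega
  by_cases hin : a ≤ i.val ∧ i.val < b
  · obtain ⟨hai, hib⟩ := hin
    have hself : c i ≤ grains (Sandpile.send i A c) i.val + A.card := by
      rw [grains_val]
      simp only [Sandpile.send, if_true]
      omega
    have hcard := card_le_of_subset_neighborFinset hA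
    have hdeg : deg (fan n) i ≤ c i := hi
    rw [deg_fan] at hdeg
    rw [← Finset.sum_Ico_consecutive _ hai hib.le, Finset.sum_eq_sum_Ico_succ_bot hib]
    have hl1 := hasVertex_le_one A i.val
    have hr1 := hasVertex_le_one A (i.val + 2)
    -- The bound on the piece left of `i` improves by the grain sent to the left neighbour, which is
    -- the last vertex of this piece. The right piece is treated symmetrically.
    have hleft : a < i.val → i.val + hasVertex A i.val ≤
        a + 1 + ∑ j ∈ Finset.Ico a i.val, grains (Sandpile.send i A c) j := by
      intro ha
      have h1 := h a i.val hai (by omega)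
      obtain ⟨m, hm⟩ := Nat.exists_eq_add_of_lt ha
      have h2 := hasVertex_succ_le_grains_send i A c (j := a + m) (by omega) (by omega)
      have h3 := hsum a (a + m) (Or.inr (by omega))
      rw [hm] at h1 ⊢
      rw [Finset.sum_Ico_succ_top (by omega)] at h1 ⊢
      omega
    have hright : i.val + 1 < b → b + hasVertex A (i.val + 2) ≤
        i.val + 2 + ∑ j ∈ Finset.Ico (i.val + 1) b, grains (Sandpile.send i A c) j := by
      intro hb'
      have h1 := h (i.val + 1) b hb'.le hb
      have h2 : _ + hasVertex A (i.val + 2) ≤ _ :=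
        hasVertex_succ_le_grains_send i A c (j := i.val + 1) (by omega) (by omega)
      have h3 := hsum (i.val + 1 + 1) b (Or.inl (by omega))
      rw [Finset.sum_eq_sum_Ico_succ_bot hb'] at h1 ⊢
      omega
    by_cases h1 : a < i.val <;> by_cases h2 : i.val + 1 < b
    · have := hleft h1
      have := hright h2
      rw [if_pos (by omega)] at hdeg hcard
      rw [if_pos (by omega)] at hdeg
      omega
    · have := hleft h1
      rw [if_pos (by omega)] at hdeg hcard
      split_ifs at hdeg with h3
      · omega
      -- Here `i` is the last vertex: its degree is one less, but it has no right neighbour to send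
      -- to.
      · have : hasVertex A (i.val + 2) = 0 := by
          refine if_neg fun h => ?_
          obtain ⟨y, _, hy⟩ := Finset.mem_map.1 h
          have := y.isLt
          simp only [Fin.valEmbedding_apply] at hy
          omega
        omega
    · have := hright h2
      rw [if_pos (show i.val + 1 < n by omega)] at hdeg
      split_ifs at hdeg hcard <;> omega
    · omega
  · have := h a b hab hb
    have := hsum a b (by omega)
    omega

lemma IntervalBound.legalTopple {c d : Config n} (h : IntervalBound c)
    (hcd : LegalTopple (fan n) c d) : IntervalBound d := by
  obtain ⟨i, hi, rfl⟩ := hcd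
  exact h.send hi subset_rfl

lemma IntervalBound.reflTransGen {c d : Config n} (h : IntervalBound c)
    (hcd : Relation.ReflTransGen (LegalTopple (fan n)) c d) : IntervalBound d := by
  induction hcd with
  | refl => exact h
  | tail _ h' ih => exact ih.legalTopple h'

lemma le_addGrain (c : Config n) (i : Fin n) : c ≤ addGrain c i := le_add_right le_rfl

/-! ### Dhar's burning argument -/

section Burning

/-- The number of neighbours of `i` in the set `A` of non-sink vertices. -/
def degIn (A : Finset (Fin n)) (i : Fin n) : ℕ :=
  ∑ j ∈ A, if (fan n).Adj i.succ j.succ then 1 else 0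

lemma degIn_le {A : Finset (Fin n)} (i : Fin n) :
    degIn A i ≤ (if 0 < i.val then hasVertex A (i.val - 1) else 0) + hasVertex A (i.val + 1) := by
  rw [degIn, Finset.sum_boole, Nat.cast_id]
  have hsub : ∀ v, hasVertex (A.filter fun j => (fan n).Adj i.succ j.succ) v ≤ hasVertex A v := by
    intro v
    unfold hasVertex
    split_ifs with h1 h2 <;> simp
    exact h2 (Finset.map_subset_map.2 (Finset.filter_subset _ _) h1)
  have hn : hasVertex (A.filter fun j => (fan n).Adj i.succ j.succ) n = 0 := by
    refine if_neg fun h => ?_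
    obtain ⟨y, _, hy⟩ := Finset.mem_map.1 h
    have := y.isLt
    simp only [Fin.valEmbedding_apply] at hy
    omega
  split_ifs with hi
  · have h1 := card_le_of_forall_val (A.filter fun j => (fan n).Adj i.succ j.succ)
      (i.val - 1) (i.val + 1) n (fun x hx => by
        have := (fan_adj_succ _ _).1 (Finset.mem_filter.1 hx).2
        omega)
    have h2 := hsub (i.val - 1)
    have h3 := hsub (i.val + 1)
    omega
  · have h1 := card_le_of_forall_val (A.filter fun j => (fan n).Adj i.succ j.succ)
      (i.val + 1) n n (fun x hx => by
        have := (fan_adj_succ _ _).1 (Finset.mem_filter.1 hx).2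
        omega)
    have h3 := hsub (i.val + 1)
    omega

/-- Every nonempty set of unburnt vertices contains one that burns next. -/
lemma IntervalBound.exists_degIn_le {c : Config n} (h : IntervalBound c) {A : Finset (Fin n)}
    (hA : A.Nonempty) : ∃ v ∈ A, degIn A v ≤ c v := by
  by_contra! hcon
  obtain ⟨a, haA, hmin⟩ := A.exists_min_image (fun v => v) hA
  -- If nothing in `A` burns, then `A` contains every vertex from its minimum `a` rightwards, past
  -- the end of the path. The invariant says that the vertices before `v` carry so few grains that
  -- the interval bound forces `v` to have a grain for a left neighbour in `A`; as `v` does not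
  -- burn, it must also have a right neighbour in `A`.
  have key : ∀ m : ℕ, ∃ v ∈ A, v.val = a.val + m ∧ ∑ j ∈ Finset.Ico a.val (a.val + m), grains c j +
      (if 0 < v.val then hasVertex A (v.val - 1) else 0) ≤ m := by
    intro m
    induction m with
    | zero =>
      refine ⟨a, haA, rfl, ?_⟩
      have : (if 0 < a.val then hasVertex A (a.val - 1) else 0) = 0 := by
        split_ifs with h0
        · refine if_neg fun hm => ?_
          obtain ⟨y, hy, hyv⟩ := Finset.mem_map.1 hm
          have : a.val ≤ y.val := hmin y hy
          simp only [Fin.valEmbedding_apply] at hyv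
          omega
        · rfl
      rw [this]
      simp
    | succ m ih =>
      obtain ⟨v, hv, hvm, hS⟩ := ih
      have h1 := hcon v hv
      have h2 := degIn_le (A := A) v
      have h3 := h a.val (a.val + m + 1) (by omega) (by omega)
      rw [Finset.sum_Ico_succ_top (by omega), ← hvm, grains_val, hvm] at h3
      have hr : hasVertex A (v.val + 1) ≠ 0 := by omega
      have hr' : v.val + 1 ∈ A.map Fin.valEmbedding := by
        by_contra hne
        exact hr (if_neg hne)
      obtain ⟨w, hw, hwv⟩ := Finset.mem_map.1 hr'
      simp only [Fin.valEmbedding_apply] at hwv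
      refine ⟨w, hw, by omega, ?_⟩
      have h4 : (if 0 < w.val then hasVertex A (w.val - 1) else 0) ≤ 1 := by
        split_ifs
        · exact hasVertex_le_one _ _
        · simp
      have h5 := hasVertex_le_one A (v.val + 1)
      rw [← add_assoc, Finset.sum_Ico_succ_top (by omega), ← hvm, grains_val, hvm]
      omega
  obtain ⟨v, _, hv, _⟩ := key n
  have := v.isLt
  omega

lemma degIn_add_degIn_compl (A : Finset (Fin n)) (i : Fin n) :
    1 + (degIn A i + degIn Aᶜ i) = deg (fan n) i := by
  rw [deg_eq_add_sum, degIn, degIn, Finset.sum_add_sum_compl]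

/-- A configuration with one extra grain on every vertex topples back to itself. -/
lemma IntervalBound.burn {c : Config n} (h : IntervalBound c) :
    Relation.ReflTransGen (LegalTopple (fan n)) (c + 1) c := by
  -- `A` is the set of unburnt vertices, and `x` is `c + 1` after every vertex outside `A` has
  -- toppled once. At `A = ∅` each vertex has sent and received one grain along each path edge, and
  -- its extra grain has gone to the sink.
  have key : ∀ (A : Finset (Fin n)) (x : Config n),
      (∀ j, x j + (if j ∈ A then 0 else deg (fan n) j) = c j + 1 + degIn Aᶜ j) →
      Relation.ReflTransGen (LegalTopple (fan n)) x c := by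
    intro A
    induction A using Finset.strongInduction with
    | H A ih =>
      intro x hx
      rcases A.eq_empty_or_nonempty with rfl | hA
      · have : x = c := by
          funext j
          have h1 := hx j
          have h2 := degIn_add_degIn_compl ∅ j
          simp only [Finset.notMem_empty, if_false] at h1
          simp only [degIn, Finset.sum_empty] at h1 h2
          omega
        rw [this]
      · obtain ⟨v, hv, hvc⟩ := h.exists_degIn_le hA
        have hun : Unstable (fan n) x v := by
          have h1 := hx v
          have h2 := degIn_add_degIn_compl A v
          simp only [hv, if_true] at h1
          unfold Unstable
          omega
        refine .head ⟨v, hun, rfl⟩ (ih (A.erase v) (Finset.erase_ssubset hv) _ fun j => ?_)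
        have h1 := hx j
        have h3 : degIn (A.erase v)ᶜ j =
            (if (fan n).Adj j.succ v.succ then 1 else 0) + degIn Aᶜ j := by
          rw [Finset.compl_erase, degIn, Finset.sum_insert (by simpa using hv), degIn]
        have hun' : deg (fan n) v ≤ x v := hun
        rw [h3]
        simp only [topple, Sandpile.send, card_neighborFinset_fan, SimpleGraph.mem_neighborFinset,
          (fan n).adj_comm v.succ j.succ, Finset.mem_erase]
        by_cases hj : j = v
        · subst hj
          simp only [hv, if_true] at h1
          simp
          omega
        · simp only [hj, if_false, ne_eq, not_false_eq_true, true_and]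
          omega
  refine key Finset.univ _ fun j => ?_
  simp [degIn]

lemma IntervalBound.burn_nsmul {c : Config n} (h : IntervalBound c) (m : ℕ) :
    Relation.ReflTransGen (LegalTopple (fan n)) (c + m • 1) c := by
  induction m with
  | zero => rw [zero_nsmul, add_zero]
  | succ m ih =>
    rw [succ_nsmul', ← add_assoc]
    exact (reflTransGen_add h.burn _).trans ih

end Burning

/-! ### Recurrent states of a chain containing the Abelian moves -/

section Recurrence

/-- The stable configuration with the largest number of grains. -/
def maxStable (n : ℕ) : Config n := fun i => deg (fan n) i - 1

lemma stable_iff_le_maxStable {c : Config n} : Stable (fan n) c ↔ c ≤ maxStable n := by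
  refine forall_congr' fun i => ?_
  have := deg_pos_fan i
  simp only [maxStable]
  omega

lemma intervalBound_maxStable : IntervalBound (maxStable n) := by
  intro a b hab hb
  -- For `n < 2` no interval has an inner edge; otherwise all degrees are at least two, so every
  -- vertex has a grain.
  rcases Nat.lt_or_ge n 2 with hn | hn
  · omega
  · have : ∑ j ∈ Finset.Ico a b, 1 ≤ ∑ j ∈ Finset.Ico a b, grains (maxStable n) j := by
      refine Finset.sum_le_sum fun j hj => ?_
      have hjn : j < n := by
        rw [Finset.mem_Ico] at hj
        omega
      rw [grains, dif_pos hjn, maxStable, deg_fan]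
      simp only
      split_ifs <;> omega
    simp at this
    omega

lemma finite_stable : {c : Config n | Stable (fan n) c}.Finite :=
  (Set.finite_Iic (maxStable n)).subset fun _ hc => stable_iff_le_maxStable.1 hc

lemma stabilise_stabilise_add (c x : Config n) :
    stabilise (fan n) (stabilise (fan n) c + x) = stabilise (fan n) (c + x) :=
  (IsStabilisation.of_reflTransGen (stabilise_spec (c + x))
    (reflTransGen_add (stabilise_spec c).1 x)).stabilise_eq

variable {μ : PMF (Fin n)}

lemma canStep_asmStep (hμ : ∀ i, 0 < μ i) (c : Config n) (i : Fin n) :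
    CanStep (asmStep (fan n) μ) c (stabilise (fan n) (addGrain c i)) :=
  (PMF.mem_support_map_iff _ _ _).2 ⟨i, (PMF.mem_support_iff _ _).2 (hμ i).ne', rfl⟩

/-- The chain can add any configuration and stabilise. -/
lemma asm_reach_stabilise_add (hμ : ∀ i, 0 < μ i) {c : Config n} (hc : Stable (fan n) c)
    (x : Config n) :
    Relation.ReflTransGen (CanStep (asmStep (fan n) μ)) c (stabilise (fan n) (c + x)) := by
  induction h : total x generalizing x with
  | zero =>
    have : x = 0 := by
      funext i
      exact (Finset.sum_eq_zero_iff.1 h) i (Finset.mem_univ i)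
    rw [this, add_zero, hc.stabilise_eq]
  | succ m ih =>
    obtain ⟨i, -, hi⟩ := Finset.exists_ne_zero_of_sum_ne_zero
      (show ∑ i, x i ≠ 0 by unfold total at h; omega)
    obtain ⟨y, rfl⟩ : ∃ y : Config n, x = y + Pi.single i 1 := by
      refine ⟨x - Pi.single i 1, (tsub_add_cancel_of_le fun j => ?_).symm⟩
      by_cases hj : j = i
      · subst hj; simp; omega
      · simp [hj]
    have hy : total y = m := by
      simp only [total, Pi.add_apply, Finset.sum_add_distrib, Finset.sum_pi_single',
        Finset.mem_univ, if_true] at h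
      unfold total
      omega
    refine (ih y hy).tail ?_
    have := canStep_asmStep hμ (stabilise (fan n) (c + y)) i
    rwa [addGrain, stabilise_stabilise_add, add_assoc] at this

lemma asm_reach_maxStable (hμ : ∀ i, 0 < μ i) {c : Config n} (hc : Stable (fan n) c) :
    Relation.ReflTransGen (CanStep (asmStep (fan n) μ)) c (maxStable n) := by
  have := asm_reach_stabilise_add hμ hc (maxStable n - c)
  rwa [add_tsub_cancel_of_le (stable_iff_le_maxStable.1 hc),
    (stable_iff_le_maxStable.2 le_rfl).stabilise_eq] at this

/-- Degrees are at most three, so `c + 3 • 1` dominates `maxStable n`. The chain can add the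
difference, and burning three times stabilises the result to `c`. -/
lemma asm_maxStable_reach (hμ : ∀ i, 0 < μ i) {c : Config n} (hc : Stable (fan n) c)
    (hb : IntervalBound c) :
    Relation.ReflTransGen (CanStep (asmStep (fan n) μ)) (maxStable n) c := by
  have hle : maxStable n ≤ c + 3 • 1 := fun i => by
    have := deg_le_three i
    simp [maxStable]
    omega
  have := asm_reach_stabilise_add hμ (stable_iff_le_maxStable.2 le_rfl) (c + 3 • 1 - maxStable n)
  rwa [add_tsub_cancel_of_le hle,
    IsStabilisation.stabilise_eq ⟨hb.burn_nsmul 3, hc⟩] at this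

/-- A chain on stable configurations that can make all the moves of the Abelian chain and that
preserves the bound on intervals has the stable configurations with that bound as its recurrent
states. -/
lemma isRecurrentState_iff_intervalBound (hμ : ∀ i, 0 < μ i) (K : Config n → PMF (Config n))
    (hK : ∀ c d, CanStep (asmStep (fan n) μ) c d → CanStep K c d)
    (hS : ∀ c d, CanStep K c d → Stable (fan n) d)
    (hI : ∀ c d, IntervalBound c → CanStep K c d → IntervalBound d)
    {c : Config n} (hc : Stable (fan n) c) : IsRecurrentState K c ↔ IntervalBound c := by
  have hmono : ∀ c d, Relation.ReflTransGen (CanStep (asmStep (fan n) μ)) c d →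
      Relation.ReflTransGen (CanStep K) c d := fun _ _ h => h.lift id hK
  constructor
  · intro hrec
    by_contra hb
    -- The interval bound defines a closed set. It misses `c` but contains `maxStable n`, which is
    -- reachable from `c`.
    exact not_isRecurrentState K (C := {d | IntervalBound d}) (fun x hx z hz => hI x z hx hz) hb
      intervalBound_maxStable (hmono _ _ (asm_reach_maxStable hμ hc)) hrec
  · intro hb
    refine isRecurrentState_of_finite K (C := {d | Stable (fan n) d ∧ IntervalBound d})
      (finite_stable.subset fun d hd => hd.1)
      (fun x hx z hz => ⟨hS x z hz, hI x z hx.2 hz⟩) ⟨hc, hb⟩ fun x hx => ?_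
    exact (hmono _ _ (asm_reach_maxStable hμ hx.1)).trans
      (hmono _ _ (asm_maxStable_reach hμ hc hb))

theorem mem_ASMRec_iff (hμ : ∀ i, 0 < μ i) (c : Config n) :
    c ∈ ASMRec (fan n) μ ↔ Stable (fan n) c ∧ IntervalBound c := by
  have hstep : ∀ c d, CanStep (asmStep (fan n) μ) c d →
      ∃ i, stabilise (fan n) (addGrain c i) = d := by
    intro c d h
    obtain ⟨i, -, hi⟩ := (PMF.mem_support_map_iff _ _ _).1 h
    exact ⟨i, hi⟩
  refine and_congr_right fun hc => isRecurrentState_iff_intervalBound hμ _ (fun _ _ h => h) ?_ ?_ hc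
  · intro c d h
    obtain ⟨i, rfl⟩ := hstep c d h
    exact (stabilise_spec _).2
  · intro c d hb h
    obtain ⟨i, rfl⟩ := hstep c d h
    exact (hb.mono (le_addGrain c i)).reflTransGen (stabilise_spec _).1

end Recurrence

/-! ### Random stabilisation and the stochastic model -/

section Mean

variable {α β : Type*}

lemma tsum_bind_mul (P : PMF α) (f : α → PMF β) (g : β → ℝ≥0∞) :
    ∑' b, P.bind f b * g b = ∑' a, P a * ∑' b, f a b * g b := by
  simp only [PMF.bind_apply, ← ENNReal.tsum_mul_right, ← ENNReal.tsum_mul_left]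
  rw [ENNReal.tsum_comm]
  simp only [mul_assoc]

lemma tsum_pure_mul (a : α) (g : α → ℝ≥0∞) : ∑' b, PMF.pure a b * g b = g a := by
  rw [tsum_eq_single a fun b hb => by rw [PMF.pure_apply_of_ne _ _ hb, zero_mul],
    PMF.pure_apply_self, one_mul]

lemma tsum_map_mul (P : PMF α) (f : α → β) (g : β → ℝ≥0∞) :
    ∑' b, P.map f b * g b = ∑' a, P a * g (f a) := by
  rw [PMF.map, tsum_bind_mul]
  simp only [Function.comp_apply, tsum_pure_mul]

end Mean

section RandomSubset

variable {α : Type*} [DecidableEq α] {p : ℝ≥0} (hp : p ≤ 1)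

lemma mem_support_randomSubset (hp0 : 0 < p) (hp1 : p < 1) (N A : Finset α) :
    A ∈ (randomSubset p hp N).support ↔ A ⊆ N := by
  rw [randomSubset, PMF.mem_support_ofFinset_iff, Finset.mem_powerset]
  refine and_iff_left_of_imp fun h => ?_
  rw [if_pos h]
  refine mul_ne_zero (pow_ne_zero _ ?_) (pow_ne_zero _ ?_)
  · exact_mod_cast hp0.ne'
  · exact_mod_cast (tsub_pos_of_lt hp1).ne'

lemma randomSubset_self (N : Finset α) : randomSubset p hp N N = (p : ℝ≥0∞) ^ N.card := by
  rw [randomSubset, PMF.ofFinset_apply]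
  simp

end RandomSubset

section RandomTopple

variable {p : ℝ≥0} (hp : p ≤ 1)

lemma mem_support_randomTopple (hp0 : 0 < p) (hp1 : p < 1) (i : Fin n) (c d : Config n) :
    d ∈ (randomTopple (fan n) p hp i c).support ↔
      ∃ A ⊆ (fan n).neighborFinset i.succ, send i A c = d := by
  rw [randomTopple, PMF.mem_support_map_iff]
  simp only [mem_support_randomSubset hp hp0 hp1]

lemma subset_of_randomSubset_ne_zero {α : Type*} [DecidableEq α] {N A : Finset α}
    (h : randomSubset p hp N A ≠ 0) : A ⊆ N := by
  by_contra hA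
  exact h (PMF.ofFinset_apply_of_notMem _ _ (by simpa using hA))

/-- A random toppling loses a positive number of grains on average. -/
lemma mean_total_randomTopple (i : Fin n) (c : Config n) (hi : Unstable (fan n) c i) :
    ∑' d, randomTopple (fan n) p hp i c d * (total d : ℝ≥0∞) + (p : ℝ≥0∞) ^ 3 ≤ total c := by
  rw [randomTopple, tsum_map_mul]
  set N := (fan n).neighborFinset i.succ with hN
  have hcard : N.card = deg (fan n) i := card_neighborFinset_fan i
  have h1 : ∀ A, randomSubset p hp N A * (total (send i A c) : ℝ≥0∞) +
      randomSubset p hp N A * (if 0 ∈ A then 1 else 0) =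
      randomSubset p hp N A * (total c : ℝ≥0∞) := by
    intro A
    by_cases hA : randomSubset p hp N A = 0
    · simp [hA]
    · have hle : A.card ≤ c i :=
        (Finset.card_le_card (subset_of_randomSubset_ne_zero hp hA)).trans (hcard.le.trans hi)
      rw [← mul_add, ← total_send i A c hle]
      push_cast
      rfl
  have h2 : ∑' A, randomSubset p hp N A * (total c : ℝ≥0∞) = total c := by
    rw [ENNReal.tsum_mul_right, PMF.tsum_coe, one_mul]
  rw [← h2, ← tsum_congr h1, ENNReal.tsum_add]
  refine add_le_add le_rfl ?_
  -- Among the outcomes that send a grain to the sink, only the full neighbourhood is kept; its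
  -- probability is at least `p ^ 3` since degrees are at most three.
  refine le_trans ?_ (ENNReal.le_tsum N)
  rw [if_pos (by simpa [hN] using fan_adj_zero i), mul_one, randomSubset_self, hcard]
  exact pow_le_pow_right_of_le_one' (by exact_mod_cast hp) (deg_le_three i)

end RandomTopple

section RandomStabilisation

variable {σ : Config n → Fin n} {p : ℝ≥0} (hp : p ≤ 1)

/-- The probability that the configuration is still unstable after `t` random topplings. -/
noncomputable def unstableProb (σ : Config n → Fin n) (p : ℝ≥0) (hp : p ≤ 1) (c : Config n)
    (t : ℕ) : ℝ≥0∞ :=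
  ∑' d, afterTopplings (fan n) σ p hp c t d * (if Stable (fan n) d then 0 else 1)

/-- The mean total drops by at least `p ^ 3` times the probability of still being unstable. Since it
cannot become negative, the expected number of topplings is bounded, whence termination. -/
lemma mean_total_afterTopplings (hσ : IsTopplingRule (fan n) σ) (c : Config n) (t : ℕ) :
    ∑' d, afterTopplings (fan n) σ p hp c t d * (total d : ℝ≥0∞) +
      ∑ s ∈ Finset.range t, unstableProb σ p hp c s * (p : ℝ≥0∞) ^ 3 ≤ total c := by
  induction t with
  | zero => simp [afterTopplings]
  | succ t ih =>
    refine le_trans ?_ ih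
    rw [Finset.sum_range_succ, add_comm (∑ s ∈ _, _), ← add_assoc]
    refine add_le_add ?_ le_rfl
    rw [unstableProb, ← ENNReal.tsum_mul_right, afterTopplings, tsum_bind_mul, ← ENNReal.tsum_add]
    refine ENNReal.tsum_le_tsum fun d => ?_
    rw [mul_assoc, ← mul_add]
    gcongr
    split_ifs with hd
    · simp
    · rw [one_mul]
      exact mean_total_randomTopple hp _ _ (hσ d hd)

lemma exists_unstableProb_lt (hp0 : 0 < p) (hσ : IsTopplingRule (fan n) σ) (c : Config n)
    {ε : ℝ≥0∞} (hε : ε ≠ 0) : ∃ t, unstableProb σ p hp c t < ε := by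
  by_contra! h
  have hne : ε * (p : ℝ≥0∞) ^ 3 ≠ 0 :=
    mul_ne_zero hε (pow_ne_zero _ (by exact_mod_cast hp0.ne'))
  obtain ⟨T, hT⟩ := ENNReal.exists_nat_mul_gt hne (ENNReal.natCast_ne_top (total c))
  refine absurd (mean_total_afterTopplings hp hσ c T) (not_le.2 (hT.trans_le ?_))
  refine le_trans ?_ le_add_self
  calc (T : ℝ≥0∞) * (ε * (p : ℝ≥0∞) ^ 3) = ∑ s ∈ Finset.range T, ε * (p : ℝ≥0∞) ^ 3 := by
        simp
    _ ≤ _ := Finset.sum_le_sum fun s _ => by gcongr; exact h s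

lemma afterTopplings_mono (c : Config n) {d : Config n} (hd : Stable (fan n) d) :
    Monotone fun t => afterTopplings (fan n) σ p hp c t d := by
  refine monotone_nat_of_le_succ fun t => ?_
  rw [afterTopplings, PMF.bind_apply]
  refine le_trans ?_ (ENNReal.le_tsum d)
  rw [if_pos hd, PMF.pure_apply_self, mul_one]

lemma stabilisationProb_eq (c d : Config n) :
    stabilisationProb (fan n) σ p hp c d =
      ⨆ t, afterTopplings (fan n) σ p hp c t d * (if Stable (fan n) d then 1 else 0) := by
  unfold stabilisationProb
  split_ifs <;> simp

/-- Random toppling almost surely ends. -/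
lemma hasSum_stabilisationProb (hp0 : 0 < p) (hσ : IsTopplingRule (fan n) σ) (c : Config n) :
    HasSum (stabilisationProb (fan n) σ p hp c) 1 := by
  rw [ENNReal.summable.hasSum_iff]
  refine le_antisymm ?_ ?_
  · rw [ENNReal.tsum_eq_iSup_sum]
    refine iSup_le fun s => ?_
    simp only [stabilisationProb_eq]
    rw [ENNReal.finsetSum_iSup_of_monotone]
    · refine iSup_le fun t => ?_
      refine (ENNReal.sum_le_tsum s).trans ?_
      rw [← PMF.tsum_coe (afterTopplings (fan n) σ p hp c t)]
      refine ENNReal.tsum_le_tsum fun d => ?_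
      split_ifs <;> simp
    · intro d
      split_ifs with hd
      · simpa using afterTopplings_mono hp c hd
      · simp [monotone_const]
  -- At a late time `t` the mass on unstable configurations is below `ε`; the remaining mass is
  -- bounded by the stabilisation probabilities.
  · refine ENNReal.le_of_forall_pos_le_add fun ε hε _ => ?_
    obtain ⟨t, ht⟩ := exists_unstableProb_lt hp hp0 hσ c (ε := ε) (by exact_mod_cast hε.ne')
    rw [← PMF.tsum_coe (afterTopplings (fan n) σ p hp c t)]
    refine le_trans ?_ (add_le_add le_rfl ht.le)
    rw [unstableProb, ← ENNReal.tsum_add]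
    refine ENNReal.tsum_le_tsum fun d => ?_
    rw [stabilisationProb_eq]
    split_ifs with hd
    · simp only [mul_one, mul_zero, add_zero]
      exact le_iSup (fun t => afterTopplings (fan n) σ p hp c t d) t
    · simp

lemma mem_support_randomStabilise (hp0 : 0 < p) (hσ : IsTopplingRule (fan n) σ)
    (c d : Config n) : d ∈ (randomStabilise (fan n) σ p hp c).support ↔
      Stable (fan n) d ∧ ∃ t, d ∈ (afterTopplings (fan n) σ p hp c t).support := by
  rw [randomStabilise, dif_pos (hasSum_stabilisationProb hp hp0 hσ c), PMF.mem_support_iff]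
  change stabilisationProb (fan n) σ p hp c d ≠ 0 ↔ _
  unfold stabilisationProb
  split_ifs with hd
  · simp [hd]
  · simp [hd]

lemma IntervalBound.of_mem_support_afterTopplings (hp0 : 0 < p) (hp1 : p < 1)
    (hσ : IsTopplingRule (fan n) σ) {c : Config n} (h : IntervalBound c) {t : ℕ} {d : Config n}
    (hd : d ∈ (afterTopplings (fan n) σ p hp c t).support) : IntervalBound d := by
  induction t generalizing d with
  | zero =>
    rw [afterTopplings, PMF.mem_support_pure_iff] at hd
    exact hd ▸ h
  | succ t ih =>
    rw [afterTopplings, PMF.mem_support_bind_iff] at hd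
    obtain ⟨e, he, hd⟩ := hd
    split_ifs at hd with hs
    · rw [PMF.mem_support_pure_iff] at hd
      exact hd ▸ ih he
    · obtain ⟨A, hA, rfl⟩ := (mem_support_randomTopple hp hp0 hp1 _ _ _).1 hd
      exact (ih he).send (hσ e hs) hA

/-- Random toppling follows the Abelian toppling with positive probability. -/
lemma exists_mem_support_afterTopplings (hp0 : 0 < p) (hp1 : p < 1)
    (hσ : IsTopplingRule (fan n) σ) (c : Config n) {d s : Config n} {t : ℕ}
    (hd : d ∈ (afterTopplings (fan n) σ p hp c t).support) (hs : IsStabilisation (fan n) d s) :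
    ∃ u, s ∈ (afterTopplings (fan n) σ p hp c u).support := by
  induction h : total d using Nat.strong_induction_on generalizing d t with
  | _ m ih =>
    subst h
    by_cases hst : Stable (fan n) d
    · rw [hst.eq_of_reflTransGen hs.1]
      exact ⟨t, hd⟩
    · have hl : LegalTopple (fan n) d (topple (fan n) (σ d) d) := ⟨σ d, hσ d hst, rfl⟩
      -- The rule imposes the vertex `σ d`, but by confluence the Abelian stabilisation is still `s`
      -- after toppling it.
      refine ih _ hl.total_lt (d := topple (fan n) (σ d) d) (t := t + 1) ?_
        (hs.of_reflTransGen (.single hl)) rfl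
      rw [afterTopplings, PMF.mem_support_bind_iff]
      refine ⟨d, hd, ?_⟩
      rw [if_neg hst, mem_support_randomTopple hp hp0 hp1]
      exact ⟨_, subset_rfl, rfl⟩

theorem mem_SSMRec_iff {μ : PMF (Fin n)} (hμ : ∀ i, 0 < μ i) (hp0 : 0 < p) (hp1 : p < 1)
    (hσ : IsTopplingRule (fan n) σ) (c : Config n) :
    c ∈ SSMRec (fan n) σ p hp μ ↔ Stable (fan n) c ∧ IntervalBound c := by
  have hstep : ∀ c d, CanStep (ssmStep (fan n) σ p hp μ) c d ↔ Stable (fan n) d ∧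
      ∃ i t, d ∈ (afterTopplings (fan n) σ p hp (addGrain c i) t).support := by
    intro c d
    rw [CanStep, ssmStep, PMF.mem_support_bind_iff]
    simp only [mem_support_randomStabilise hp hp0 hσ]
    constructor
    · rintro ⟨i, -, hd, t, ht⟩
      exact ⟨hd, i, t, ht⟩
    · rintro ⟨hd, i, t, ht⟩
      exact ⟨i, (PMF.mem_support_iff _ _).2 (hμ i).ne', hd, t, ht⟩
  refine and_congr_right fun hc => isRecurrentState_iff_intervalBound hμ _ ?_ ?_ ?_ hc
  · intro c d h
    obtain ⟨i, -, rfl⟩ := (PMF.mem_support_map_iff _ _ _).1 h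
    refine (hstep _ _).2 ⟨(stabilise_spec _).2, i, ?_⟩
    refine exists_mem_support_afterTopplings hp hp0 hp1 hσ _ (d := addGrain c i) (t := 0) ?_
      (stabilise_spec _)
    rw [afterTopplings, PMF.mem_support_pure_iff]
  · exact fun c d h => ((hstep c d).1 h).1
  · intro c d hb h
    obtain ⟨-, i, t, ht⟩ := (hstep c d).1 h
    exact (hb.mono (le_addGrain c i)).of_mem_support_afterTopplings hp hp0 hp1 hσ ht

end RandomStabilisation

/-! ### Counting by removal of the first vertex -/

section Counting

lemma grains_cons_zero (x : ℕ) (w : Config n) :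
    grains (Fin.cons x w : Config (n + 1)) 0 = x := by
  simp only [grains, Nat.zero_lt_succ, dif_pos]
  rfl

lemma grains_cons_succ (x : ℕ) (w : Config n) (j : ℕ) :
    grains (Fin.cons x w : Config (n + 1)) (j + 1) = grains w j := by
  simp only [grains, Nat.add_lt_add_iff_right]
  split_ifs
  · rfl
  · rfl

lemma total_cons (x : ℕ) (w : Config n) :
    total (Fin.cons x w : Config (n + 1)) = x + total w := by
  simp [total, Fin.sum_univ_succ]

lemma total_eq_sum_grains (w : Config n) : total w = ∑ j ∈ Finset.range n, grains w j := by
  rw [total, Finset.sum_range]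
  simp [grains_val]

/-- Every initial segment of the path carries at least as many grains as it has vertices. -/
def PrefixBound (w : Config n) : Prop := ∀ b ≤ n, b ≤ ∑ j ∈ Finset.range b, grains w j

lemma sum_range_grains_cons (x : ℕ) (w : Config n) (b : ℕ) :
    ∑ j ∈ Finset.range (b + 1), grains (Fin.cons x w : Config (n + 1)) j =
      x + ∑ j ∈ Finset.range b, grains w j := by
  rw [Finset.sum_range_succ', grains_cons_zero, add_comm]
  simp only [grains_cons_succ]

lemma IntervalBound.range {w : Config n} (h : IntervalBound w) {b : ℕ} (hb : b ≤ n) :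
    b ≤ 1 + ∑ j ∈ Finset.range b, grains w j := by
  have := h 0 b (Nat.zero_le _) hb
  rw [Finset.range_eq_Ico]
  omega

lemma intervalBound_cons (x : ℕ) (w : Config n) :
    IntervalBound (Fin.cons x w : Config (n + 1)) ↔
      IntervalBound w ∧ ∀ b ≤ n, b ≤ x + ∑ j ∈ Finset.range b, grains w j := by
  have hshift : ∀ a b, ∑ j ∈ Finset.Ico (a + 1) (b + 1),
      grains (Fin.cons x w : Config (n + 1)) j = ∑ j ∈ Finset.Ico a b, grains w j := by
    intro a b
    rw [← Finset.sum_Ico_add']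
    simp only [grains_cons_succ]
  constructor
  · intro h
    refine ⟨fun a b hab hb => ?_, fun b hb => ?_⟩
    · have := h (a + 1) (b + 1) (by omega) (by omega)
      rw [hshift] at this
      omega
    · have := h.range (b := b + 1) (by omega)
      rw [sum_range_grains_cons] at this
      omega
  · rintro ⟨h1, h2⟩ a b hab hb
    rcases b with _ | b
    · omega
    rcases a with _ | a
    · rw [← Finset.range_eq_Ico, sum_range_grains_cons]
      have := h2 b (by omega)
      omega
    · rw [hshift]
      have := h1 a b (by omega) (by omega)
      omega

lemma prefixBound_cons (x : ℕ) (w : Config n) :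
    PrefixBound (Fin.cons x w : Config (n + 1)) ↔
      ∀ b ≤ n, b + 1 ≤ x + ∑ j ∈ Finset.range b, grains w j := by
  constructor
  · intro h b hb
    have := h (b + 1) (by omega)
    rwa [sum_range_grains_cons] at this
  · intro h b hb
    rcases b with _ | b
    · omega
    · rw [sum_range_grains_cons]
      exact h b (by omega)

lemma intervalBound_cons_zero (w : Config n) :
    IntervalBound (Fin.cons 0 w : Config (n + 1)) ↔ IntervalBound w ∧ PrefixBound w := by
  simp [intervalBound_cons, PrefixBound]

/-- The interval bound on `w` leaves each prefix at most one grain short of its length, and the head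
supplies that grain. -/
lemma intervalBound_cons_pos {x : ℕ} (hx : 1 ≤ x) (w : Config n) :
    IntervalBound (Fin.cons x w : Config (n + 1)) ↔ IntervalBound w := by
  rw [intervalBound_cons]
  refine and_iff_left_of_imp fun h b hb => ?_
  have := h.range hb
  omega

lemma not_prefixBound_cons_zero (w : Config n) :
    ¬ PrefixBound (Fin.cons 0 w : Config (n + 1)) := by
  rw [prefixBound_cons]
  intro h
  simpa using h 0 (Nat.zero_le _)

lemma prefixBound_cons_one (w : Config n) :
    PrefixBound (Fin.cons 1 w : Config (n + 1)) ↔ PrefixBound w := by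
  rw [prefixBound_cons]
  exact forall₂_congr fun b _ => by omega

lemma IntervalBound.prefixBound_cons_two {w : Config n} (h : IntervalBound w) :
    PrefixBound (Fin.cons 2 w : Config (n + 1)) := by
  rw [prefixBound_cons]
  intro b hb
  have := h.range hb
  omega

/-- At most one grain at the last vertex, and at most two grains at all others. -/
def Capped (w : Config n) : Prop := ∀ i : Fin n, w i ≤ if i.val + 1 < n then 2 else 1

lemma capped_cons (hn : 1 ≤ n) (x : ℕ) (w : Config n) :
    Capped (Fin.cons x w : Config (n + 1)) ↔ x ≤ 2 ∧ Capped w := by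
  rw [Capped, Fin.forall_fin_succ]
  refine and_congr ?_ (forall_congr' fun i => ?_)
  · rw [if_pos (by simp; omega), Fin.cons_zero]
  · simp

lemma finite_capped (P : Config n → Prop) : {w : Config n | Capped w ∧ P w}.Finite := by
  refine (Set.finite_Iic (fun _ => 2 : Config n)).subset fun w hw i => (hw.1 i).trans ?_
  split_ifs <;> simp

/-- The capped configurations with `n + k` grains that satisfy both bounds. -/
def tightConfigs (n k : ℕ) : Set (Config n) :=
  {w | Capped w ∧ IntervalBound w ∧ PrefixBound w ∧ total w = n + k}

/-- The capped configurations with `n + k - 1` grains that satisfy the bound on intervals. -/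
def looseConfigs (n k : ℕ) : Set (Config n) :=
  {w | Capped w ∧ IntervalBound w ∧ total w + 1 = n + k}

lemma finite_tightConfigs (n k : ℕ) : (tightConfigs n k).Finite := finite_capped _

lemma finite_looseConfigs (n k : ℕ) : (looseConfigs n k).Finite := finite_capped _

lemma exists_eq_cons (c : Config (n + 1)) : ∃ (x : ℕ) (w : Config n), c = Fin.cons x w :=
  ⟨c 0, Fin.tail c, (Fin.cons_self_tail c).symm⟩

lemma cons_injective (x : ℕ) :
    Function.Injective (fun w : Config n => (Fin.cons x w : Config (n + 1))) :=
  Fin.cons_right_injective (α := fun _ : Fin (n + 1) => ℕ) x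

lemma disjoint_image_cons {x y : ℕ} (h : x ≠ y) (A B : Set (Config n)) :
    Disjoint ((fun w : Config n => (Fin.cons x w : Config (n + 1))) '' A)
      ((fun w : Config n => (Fin.cons y w : Config (n + 1))) '' B) := by
  rw [Set.disjoint_left]
  rintro _ ⟨w, -, rfl⟩ ⟨v, -, hv⟩
  exact h (by simpa using (congrFun hv 0).symm)

lemma cons_mem_image_cons (x y : ℕ) (w : Config n) (A : Set (Config n)) :
    (Fin.cons x w : Config (n + 1)) ∈ (fun w : Config n => (Fin.cons y w : Config (n + 1))) '' A ↔
      x = y ∧ w ∈ A := by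
  constructor
  · rintro ⟨v, hv, h⟩
    obtain ⟨h1, h2⟩ := Fin.cons_inj.1 h
    exact ⟨h1.symm, h2 ▸ hv⟩
  · rintro ⟨rfl, h⟩
    exact ⟨w, h, rfl⟩

/-- A head `0` violates the prefix bound, a head `1` passes it on to `w`, and a head `2` makes it
automatic, which leaves a loose configuration. -/
lemma ncard_tightConfigs_succ (hn : 1 ≤ n) (k : ℕ) :
    (tightConfigs (n + 1) k).ncard = (tightConfigs n k).ncard + (looseConfigs n k).ncard := by
  have : tightConfigs (n + 1) k =
      (fun w : Config n => (Fin.cons 1 w : Config (n + 1))) '' tightConfigs n k ∪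
      (fun w : Config n => (Fin.cons 2 w : Config (n + 1))) '' looseConfigs n k := by
    ext c
    obtain ⟨x, w, rfl⟩ := exists_eq_cons c
    simp only [Set.mem_union, cons_mem_image_cons, tightConfigs, looseConfigs, Set.mem_ofPred_eq,
      capped_cons hn, total_cons]
    rcases x with _ | _ | _ | x
    · simp [not_prefixBound_cons_zero]
    · simp [intervalBound_cons_pos, prefixBound_cons_one]
      omega
    · rw [show 0 + 1 + 1 = 2 from rfl, intervalBound_cons_pos (by omega)]
      have := @IntervalBound.prefixBound_cons_two _ w
      constructor
      · rintro ⟨⟨-, h1⟩, h2, -, h3⟩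
        exact Or.inr ⟨rfl, h1, h2, by omega⟩
      · rintro (⟨h, -⟩ | ⟨-, h1, h2, h3⟩)
        · omega
        · exact ⟨⟨le_rfl, h1⟩, h2, this h2, by omega⟩
    · simp
  rw [this, Set.ncard_union_eq (disjoint_image_cons (by simp) _ _)
    ((finite_tightConfigs _ _).image _) ((finite_looseConfigs _ _).image _),
    Set.ncard_image_of_injective _ (cons_injective _),
    Set.ncard_image_of_injective _ (cons_injective _)]

lemma ncard_looseConfigs_succ_zero (hn : 1 ≤ n) :
    (looseConfigs (n + 1) 0).ncard = (tightConfigs n 0).ncard + (looseConfigs n 0).ncard := by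
  have : looseConfigs (n + 1) 0 =
      (fun w : Config n => (Fin.cons 0 w : Config (n + 1))) '' tightConfigs n 0 ∪
      (fun w : Config n => (Fin.cons 1 w : Config (n + 1))) '' looseConfigs n 0 := by
    ext c
    obtain ⟨x, w, rfl⟩ := exists_eq_cons c
    simp only [Set.mem_union, cons_mem_image_cons, tightConfigs, looseConfigs, Set.mem_ofPred_eq,
      capped_cons hn, total_cons]
    rcases x with _ | _ | x
    · simp [intervalBound_cons_zero, and_assoc]
    · simp [intervalBound_cons_pos]
      omega
    -- A head of at least `2` would leave `w` with fewer than `n - 1` grains, against the interval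
    -- bound on the whole path.
    · simp only [Nat.succ_ne_zero, false_and, false_or, Nat.add_eq_right]
      rw [intervalBound_cons_pos (by omega)]
      constructor
      · rintro ⟨-, h2, h3⟩
        have := h2.range le_rfl
        rw [← total_eq_sum_grains] at this
        omega
      · rintro ⟨h, -⟩
  rw [this, Set.ncard_union_eq (disjoint_image_cons (by simp) _ _)
    ((finite_tightConfigs _ _).image _) ((finite_looseConfigs _ _).image _),
    Set.ncard_image_of_injective _ (cons_injective _),
    Set.ncard_image_of_injective _ (cons_injective _)]

lemma ncard_looseConfigs_succ_succ (hn : 1 ≤ n) (k : ℕ) :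
    (looseConfigs (n + 1) (k + 1)).ncard = (tightConfigs n (k + 1)).ncard +
      (looseConfigs n (k + 1)).ncard + (looseConfigs n k).ncard := by
  have : looseConfigs (n + 1) (k + 1) =
      ((fun w : Config n => (Fin.cons 0 w : Config (n + 1))) '' tightConfigs n (k + 1) ∪
      (fun w : Config n => (Fin.cons 1 w : Config (n + 1))) '' looseConfigs n (k + 1)) ∪
      (fun w : Config n => (Fin.cons 2 w : Config (n + 1))) '' looseConfigs n k := by
    ext c
    obtain ⟨x, w, rfl⟩ := exists_eq_cons c
    simp only [Set.mem_union, cons_mem_image_cons, tightConfigs, looseConfigs, Set.mem_ofPred_eq,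
      capped_cons hn, total_cons]
    rcases x with _ | _ | _ | x
    · simp [intervalBound_cons_zero, and_assoc]
      omega
    · simp [intervalBound_cons_pos]
      omega
    · simp [intervalBound_cons_pos]
      omega
    · simp
  rw [this, Set.ncard_union_eq (Set.disjoint_union_left.2
      ⟨disjoint_image_cons (by simp) _ _, disjoint_image_cons (by simp) _ _⟩)
      (((finite_tightConfigs _ _).image _).union ((finite_looseConfigs _ _).image _)) ((finite_looseConfigs _ _).image _),
    Set.ncard_union_eq (disjoint_image_cons (by simp) _ _)
    ((finite_tightConfigs _ _).image _) ((finite_looseConfigs _ _).image _),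
    Set.ncard_image_of_injective _ (cons_injective _),
    Set.ncard_image_of_injective _ (cons_injective _),
    Set.ncard_image_of_injective _ (cons_injective _)]

lemma intervalBound_of_le_one (hn : n ≤ 1) (w : Config n) : IntervalBound w := by
  intro a b _ hb
  omega

lemma config_one_eq {w : Config 1} {x : ℕ} (h : w 0 = x) : w = fun _ => x := by
  funext i
  rw [Subsingleton.elim i 0, h]

lemma ncard_tightConfigs_one (k : ℕ) :
    (tightConfigs 1 k).ncard = if k < 1 then 1 else 0 := by
  have h : ∀ w : Config 1, w ∈ tightConfigs 1 k ↔ w 0 = 1 ∧ k = 0 := by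
    intro w
    have hp : PrefixBound w ↔ 1 ≤ w 0 := by
      constructor
      · intro h
        simpa [grains] using h 1 le_rfl
      · intro h b hb
        interval_cases b
        · simp
        · simpa [grains] using h
    simp only [tightConfigs, Set.mem_ofPred_eq, intervalBound_of_le_one le_rfl, hp, Capped, total,
      Fin.forall_fin_one, Fin.sum_univ_one]
    simp
    omega
  split_ifs with hk
  · rw [Set.ncard_eq_one]
    refine ⟨fun _ => 1, Set.ext fun w => ?_⟩
    rw [h, Set.mem_singleton_iff]
    exact ⟨fun h => config_one_eq h.1, fun h => ⟨by rw [h], by omega⟩⟩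
  · rw [Set.ncard_eq_zero (finite_tightConfigs _ _)]
    refine Set.eq_empty_of_forall_notMem fun w hw => ?_
    have := ((h w).1 hw).2
    omega

lemma ncard_looseConfigs_one (k : ℕ) :
    (looseConfigs 1 k).ncard = if k ≤ 1 then 1 else 0 := by
  have h : ∀ w : Config 1, w ∈ looseConfigs 1 k ↔ w 0 = k ∧ k ≤ 1 := by
    intro w
    simp only [looseConfigs, Set.mem_ofPred_eq, intervalBound_of_le_one le_rfl, Capped, total,
      Fin.forall_fin_one, Fin.sum_univ_one]
    simp
    omega
  split_ifs with hk
  · rw [Set.ncard_eq_one]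
    refine ⟨fun _ => k, Set.ext fun w => ?_⟩
    rw [h, Set.mem_singleton_iff]
    exact ⟨fun h => config_one_eq h.1, fun h => ⟨by rw [h], hk⟩⟩
  · rw [Set.ncard_eq_zero (finite_looseConfigs _ _)]
    exact Set.eq_empty_of_forall_notMem fun w hw => hk ((h w).1 hw).2

/-- The sum in the counting formula. -/
def tightSum (m k : ℕ) : ℕ := ∑ r ∈ Finset.range (m + 1), m.choose r * (r + k).choose r

/-- The increment of `tightSum` in its first argument. -/
def looseSum (m k : ℕ) : ℕ :=
  ∑ r ∈ Finset.range (m + 1), m.choose r * (r + 1 + k).choose (r + 1)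

/-- Pascal's rule for the first binomial coefficient, followed by an index shift. `looseSum_succ`
uses Pascal's rule for the second one. -/
lemma tightSum_succ (m k : ℕ) : tightSum (m + 1) k = tightSum m k + looseSum m k := by
  have h : tightSum m k =
      ∑ r ∈ Finset.range (m + 1), m.choose (r + 1) * (r + 1 + k).choose (r + 1) + 1 := by
    have : tightSum m k = ∑ r ∈ Finset.range (m + 1 + 1), m.choose r * (r + k).choose r := by
      rw [Finset.sum_range_succ, Nat.choose_succ_self, zero_mul, add_zero, tightSum]
    rw [this, Finset.sum_range_succ']
    simp
  rw [h, tightSum, looseSum, Finset.sum_range_succ']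
  simp only [Nat.choose_succ_succ m, add_mul, Finset.sum_add_distrib]
  simp
  omega

lemma looseSum_succ (m k : ℕ) : looseSum m (k + 1) = tightSum m (k + 1) + looseSum m k := by
  rw [looseSum, tightSum, looseSum, ← Finset.sum_add_distrib]
  refine Finset.sum_congr rfl fun r _ => ?_
  rw [← mul_add, show r + 1 + (k + 1) = (r + (k + 1)) + 1 by ring, Nat.choose_succ_succ,
    show r + 1 + k = r + (k + 1) by ring]

lemma looseSum_zero (m : ℕ) : looseSum m 0 = tightSum m 0 := by
  simp [looseSum, tightSum]

lemma tightSum_zero_left (k : ℕ) : tightSum 0 k = 1 := by simp [tightSum]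

lemma looseSum_zero_left (k : ℕ) : looseSum 0 k = k + 1 := by simp [looseSum, add_comm]

/-- The two counts need a joint induction. The boundary value `1` at `k = n + 1` counts the
configuration with every cap attained; it starts the diagonal `tightSum 0 k = 1` of the next length.
-/
lemma ncard_configs (n : ℕ) : ∀ k,
    (tightConfigs (n + 1) k).ncard = (if k < n + 1 then tightSum (n - k) k else 0) ∧
    (looseConfigs (n + 1) k).ncard =
      if k < n + 1 then looseSum (n - k) k else if k = n + 1 then 1 else 0 := by
  induction n with
  | zero =>
    intro k
    rw [ncard_tightConfigs_one, ncard_looseConfigs_one]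
    rcases k with _ | _ | k <;> simp [tightSum_zero_left, looseSum_zero_left]
  | succ n ih =>
    have hD : ∀ k, (tightConfigs (n + 1 + 1) k).ncard =
        if k < n + 1 + 1 then tightSum (n + 1 - k) k else 0 := by
      intro k
      rw [ncard_tightConfigs_succ (by omega), (ih k).1, (ih k).2]
      rcases lt_trichotomy k (n + 1) with h | rfl | h
      · rw [if_pos h, if_pos h, if_pos (by omega), show n + 1 - k = n - k + 1 by omega,
          tightSum_succ]
      · simp [tightSum_zero_left]
      · rw [if_neg (by omega), if_neg (by omega), if_neg (by omega), if_neg (by omega)]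
    intro k
    refine ⟨hD k, ?_⟩
    rcases k with _ | k
    · rw [ncard_looseConfigs_succ_zero (by omega), ← ncard_tightConfigs_succ (by omega), hD]
      simp [looseSum_zero]
    · rw [ncard_looseConfigs_succ_succ (by omega), ← ncard_tightConfigs_succ (by omega), hD,
        (ih k).2]
      rcases lt_trichotomy k (n + 1) with h | rfl | h
      · rw [if_pos h, if_pos (by omega), if_pos (by omega),
          show n + 1 - (k + 1) = n - k by omega, looseSum_succ]
      · simp
      · rw [if_neg (by omega), if_neg (by omega), if_neg (by omega), if_neg (by omega),
          if_neg (by omega)]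

/-- Of the at least two path vertices only the two ends have degree two, so after removal of the
first one stability is `Capped`. -/
lemma stable_cons (hn : 1 ≤ n) (x : ℕ) (w : Config n) :
    Stable (fan (n + 1)) (Fin.cons x w : Config (n + 1)) ↔ x ≤ 1 ∧ Capped w := by
  rw [Stable, Fin.forall_fin_succ]
  refine and_congr ?_ (forall_congr' fun i => ?_)
  · have h : deg (fan (n + 1)) 0 = 2 := by
      simp [deg_fan, Nat.lt_of_lt_of_le Nat.zero_lt_one hn]
    rw [h, Fin.cons_zero]
    omega
  · rw [deg_fan]
    simp only [Fin.cons_succ, Fin.val_succ, Nat.zero_lt_succ, if_true, Nat.add_lt_add_iff_right]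
    split_ifs <;> omega

/-- The number of stable configurations of level `k` with the bound on intervals. -/
lemma ncard_stable_intervalBound (hn : 1 ≤ n) {k : ℕ} (hk : k < n) :
    {c : Config n | (Stable (fan n) c ∧ IntervalBound c) ∧
      level (fan n) c = (k : ℤ)}.ncard = tightSum (n - k - 1) k := by
  obtain ⟨m, rfl⟩ := Nat.exists_eq_add_of_le' hn
  simp only [level_fan hn]
  rcases Nat.eq_zero_or_pos m with rfl | hm
  · obtain rfl : k = 0 := by omega
    rw [tightSum_zero_left, Set.ncard_eq_one]
    refine ⟨fun _ => 0, Set.ext fun w => ?_⟩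
    simp only [Set.mem_ofPred_eq, intervalBound_of_le_one (le_refl (0 + 1)), and_true, Stable,
      deg_fan, Set.mem_singleton_iff, total]
    constructor
    · rintro ⟨h, -⟩
      exact config_one_eq (by simpa using h 0)
    · rintro rfl
      simp
  -- The heads `0` and `1` leave exactly the two families that the heads `1` and `2` leave in
  -- `tightConfigs (m + 1) k`, so both sets have the same size.
  · have : {c : Config (m + 1) | (Stable (fan (m + 1)) c ∧ IntervalBound c) ∧
        (total c : ℤ) + 1 - ((m + 1 : ℕ) : ℤ) = (k : ℤ)} =
        (fun w : Config m => (Fin.cons 0 w : Config (m + 1))) '' tightConfigs m k ∪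
        (fun w : Config m => (Fin.cons 1 w : Config (m + 1))) '' looseConfigs m k := by
      ext c
      obtain ⟨x, w, rfl⟩ := exists_eq_cons c
      simp only [Set.mem_union, cons_mem_image_cons, tightConfigs, looseConfigs, Set.mem_ofPred_eq,
        stable_cons hm, total_cons]
      rcases x with _ | _ | x
      · simp only [intervalBound_cons_zero]
        simp [and_assoc]
        omega
      · simp only [zero_add, intervalBound_cons_pos le_rfl]
        simp [and_assoc]
        omega
      · simp
    rw [this, Set.ncard_union_eq (disjoint_image_cons (by simp) _ _)
      ((finite_tightConfigs _ _).image _) ((finite_looseConfigs _ _).image _),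
      Set.ncard_image_of_injective _ (cons_injective _),
      Set.ncard_image_of_injective _ (cons_injective _), ← ncard_tightConfigs_succ hm,
      (ncard_configs m k).1, if_pos hk]
    congr 1
    omega

end Counting

end Sandpile

/-- The number of recurrent configurations of level `k` on the fan graph `F_n`, for the Abelian and
for the stochastic sandpile model. -/
theorem corollary5p7 (n k : ℕ) (hn : 1 ≤ n) (hk : k < n)
    (μ : PMF (Fin n)) (hμ : ∀ i, 0 < μ i)
    (p : NNReal) (hp0 : 0 < p) (hp1 : p < 1)
    (σ : Sandpile.Config n → Fin n) (hσ : Sandpile.IsTopplingRule (Sandpile.fan n) σ) :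
    Set.ncard {c | c ∈ Sandpile.ASMRec (Sandpile.fan n) μ ∧
        Sandpile.level (Sandpile.fan n) c = (k : ℤ)} =
      ∑ r ∈ Finset.range (n - k - 1 + 1), (n - k - 1).choose r * (r + k).choose r ∧
    Set.ncard {c | c ∈ Sandpile.SSMRec (Sandpile.fan n) σ p hp1.le μ ∧
        Sandpile.level (Sandpile.fan n) c = (k : ℤ)} =
      ∑ r ∈ Finset.range (n - k - 1 + 1), (n - k - 1).choose r * (r + k).choose r := by
  simp only [Sandpile.mem_ASMRec_iff hμ, Sandpile.mem_SSMRec_iff hp1.le hμ hp0 hp1 hσ]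
  exact ⟨Sandpile.ncard_stable_intervalBound hn hk, Sandpile.ncard_stable_intervalBound hn hk⟩
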